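/- Let $N \ge 2$, $1<p<\infty$, let $\Omega\subset\mathbb{R}^N$ be a bounded domain with boundary of class $\mathcal{C}^{0,1}$, and let $\mu>0$ be a constant. Let $f:\Omega\times\mathbb{R}\to\mathbb{R}$ be an $L^1$-Carathéodory function, that is, $f(\cdot,s)$ is measurable for every $s\in\mathbb{R}$, $f(x,\cdot)$ is continuous for a.e. $x\in\Omega$, and for every $R>0$ there is $h_R\in L^1(\Omega)$ with $|f(x,s)|\le h_R(x)$ for a.e. $x\in\Omega$ and all $|s|\le R$. Assume that $f(x,s)\le f(x,t)$ for a.e. $x\in\Omega$ and all $t\le s$. Consider the boundary value problem $$-\Delta_p u=\mu|\nabla u|^p+f(x,u),\qquad u\in W^{1,p}_0(\Omega)\cap L^\infty(\Omega). \tag{P}$$ A function $u\in W^{1,p}(\Omega)\cap L^\infty(\Omega)$ is called a lower solution of (P) if $u^+=\max(u,0)\in W^{1,p}_0(\Omega)$ and $$\int_\Omega|\nabla u|^{p-2}\nabla u\cdot\nabla\varphi\,dx\le\int_\Omega\big(\mu|\nabla u|^p+f(x,u)\big)\varphi\,dx\qquad\text{for all }\varphi\in W^{1,p}_0(\Omega)\cap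 L^\infty(\Omega)\text{ with }\varphi\ge 0;$$ it is called an upper solution of (P) if $u^-=\max(-u,0)\in W^{1,p}_0(\Omega)$ and the reverse inequality holds for all such $\varphi$. If $u_1,u_2\in W^{1,p}(\Omega)\cap\mathcal{C}(\overline\Omega)$ are respectively a lower and an upper solution of (P), then $u_1\le u_2$ in $\overline\Omega$. -/

import Mathlib

open MeasureTheory Filter Topology
open scoped ContDiff RealInnerProductSpace

/-- `ℝ^N` with the Euclidean norm. -/
abbrev RN (N : ℕ) : Type := EuclideanSpace ℝ (Fin N)

/-- `∂Ω` is of class `C^{0,1}`: near each boundary point, in suitable orthonormal coordinates (with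
`e` the last coordinate direction), `Ω` is the strict epigraph of a Lipschitz function `γ` of the
remaining coordinates, which range over the hyperplane orthogonal to `e`. -/
def HasLipschitzBoundary {N : ℕ} (Ω : Set (RN N)) : Prop :=
  ∀ x₀ ∈ frontier Ω, ∃ e : RN N, ‖e‖ = 1 ∧
    ∃ γ : (Submodule.span ℝ {e})ᗮ → ℝ, (∃ K, LipschitzWith K γ) ∧
      ∃ r > 0, ∀ x ∈ Metric.ball x₀ r,
        x ∈ Ω ↔ γ ((Submodule.span ℝ {e})ᗮ.orthogonalProjectionOnto x) < ⟪x, e⟫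

/-- `φ ∈ C_c^∞(Ω)`. -/
def IsTestFunction {N : ℕ} (Ω : Set (RN N)) (φ : RN N → ℝ) : Prop :=
  ContDiff ℝ ∞ φ ∧ HasCompactSupport φ ∧ tsupport φ ⊆ Ω

/-- `G` is the weak (distributional) gradient of `u` in `Ω`: for every coordinate `i` and every
`φ ∈ C_c^∞(Ω)`, `∫_Ω u ∂_i φ = - ∫_Ω G_i φ`. -/
def IsWeakGradient {N : ℕ} (Ω : Set (RN N)) (u : RN N → ℝ) (G : RN N → RN N) : Prop :=
  LocallyIntegrableOn u Ω ∧ LocallyIntegrableOn G Ω ∧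
    ∀ φ : RN N → ℝ, IsTestFunction Ω φ → ∀ i : Fin N,
      ∫ x in Ω, u x * gradient φ x i = - ∫ x in Ω, G x i * φ x

open Classical in
/-- The weak gradient `∇u` in `Ω`, which is unique almost everywhere in an open set `Ω` (see
`IsWeakGradient.ae_eq`); it is set to `0` where `u` has no weak gradient. -/
noncomputable def weakGradient {N : ℕ} (Ω : Set (RN N)) (u : RN N → ℝ) : RN N → RN N :=
  if h : ∃ G, IsWeakGradient Ω u G then h.choose else 0

/-- `u ∈ L^p(Ω)`, for a real exponent `p`. -/
def MemLpOn {N : ℕ} {F : Type*} [NormedAddCommGroup F] (Ω : Set (RN N)) (p : ℝ) (u : RN N → F) :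
    Prop :=
  MemLp u (ENNReal.ofReal p) (volume.restrict Ω)

/-- `u ∈ L^∞(Ω)`. -/
def MemLinftyOn {N : ℕ} (Ω : Set (RN N)) (u : RN N → ℝ) : Prop :=
  MemLp u ⊤ (volume.restrict Ω)

/-- `u ∈ W^{1,p}(Ω)`: `u ∈ L^p(Ω)` has a weak gradient in `Ω`, and it belongs to `L^p(Ω)`. -/
def MemSobolev {N : ℕ} (Ω : Set (RN N)) (p : ℝ) (u : RN N → ℝ) : Prop :=
  MemLpOn Ω p u ∧ (∃ G, IsWeakGradient Ω u G) ∧ MemLpOn Ω p (weakGradient Ω u)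

/-- `u ∈ W_0^{1,p}(Ω)`: `u` is a limit in `W^{1,p}(Ω)` of functions of class `C_c^∞(Ω)`. -/
def MemSobolevZero {N : ℕ} (Ω : Set (RN N)) (p : ℝ) (u : RN N → ℝ) : Prop :=
  MemSobolev Ω p u ∧ ∃ φ : ℕ → RN N → ℝ, (∀ n, IsTestFunction Ω (φ n)) ∧
    Tendsto (fun n => eLpNorm (fun x => u x - φ n x) (ENNReal.ofReal p) (volume.restrict Ω))
      atTop (𝓝 0) ∧
    Tendsto (fun n => eLpNorm (fun x => weakGradient Ω u x - gradient (φ n) x)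
      (ENNReal.ofReal p) (volume.restrict Ω)) atTop (𝓝 0)

/-- `f : Ω × ℝ → ℝ` is an `L^1`-Carathéodory function: `f(·,s)` is (Lebesgue) measurable for every
`s`, `f(x,·)` is continuous for almost every `x`, and for every `R` there is `h ∈ L^1(Ω)` with
`|f(x,s)| ≤ h(x)` for almost every `x` and all `|s| ≤ R`. -/
def IsL1Caratheodory {N : ℕ} (Ω : Set (RN N)) (f : RN N → ℝ → ℝ) : Prop :=
  (∀ s : ℝ, AEMeasurable (fun x => f x s) (volume.restrict Ω)) ∧
  (∀ᵐ x ∂(volume.restrict Ω), Continuous (f x)) ∧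
  ∀ R : ℝ, ∃ h : RN N → ℝ, IntegrableOn h Ω ∧
    ∀ᵐ x ∂(volume.restrict Ω), ∀ s : ℝ, |s| ≤ R → |f x s| ≤ h x

/-- `u` is a lower solution of `-Δ_p u = F(x, u, ∇u)`, `u ∈ W_0^{1,p}(Ω) ∩ L^∞(Ω)`. -/
def IsLowerSolution {N : ℕ} (Ω : Set (RN N)) (p : ℝ) (F : RN N → ℝ → RN N → ℝ)
    (u : RN N → ℝ) : Prop :=
  MemSobolev Ω p u ∧ MemLinftyOn Ω u ∧
  MemSobolevZero Ω p (fun x => max (u x) 0) ∧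
  ∀ φ : RN N → ℝ, MemSobolevZero Ω p φ → MemLinftyOn Ω φ →
    (∀ᵐ x ∂(volume.restrict Ω), 0 ≤ φ x) →
    ∫ x in Ω, ‖weakGradient Ω u x‖ ^ (p - 2) * ⟪weakGradient Ω u x, weakGradient Ω φ x⟫
      ≤ ∫ x in Ω, F x (u x) (weakGradient Ω u x) * φ x

/-- `u` is an upper solution of `-Δ_p u = F(x, u, ∇u)`, `u ∈ W_0^{1,p}(Ω) ∩ L^∞(Ω)`. -/
def IsUpperSolution {N : ℕ} (Ω : Set (RN N)) (p : ℝ) (F : RN N → ℝ → RN N → ℝ)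
    (u : RN N → ℝ) : Prop :=
  MemSobolev Ω p u ∧ MemLinftyOn Ω u ∧
  MemSobolevZero Ω p (fun x => max (-u x) 0) ∧
  ∀ φ : RN N → ℝ, MemSobolevZero Ω p φ → MemLinftyOn Ω φ →
    (∀ᵐ x ∂(volume.restrict Ω), 0 ≤ φ x) →
    ∫ x in Ω, F x (u x) (weakGradient Ω u x) * φ x
      ≤ ∫ x in Ω, ‖weakGradient Ω u x‖ ^ (p - 2) * ⟪weakGradient Ω u x, weakGradient Ω φ x⟫

theorem isWeakGradient_weakGradient {N : ℕ} {Ω : Set (RN N)} {u : RN N → ℝ}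
    (h : ∃ G, IsWeakGradient Ω u G) : IsWeakGradient Ω u (weakGradient Ω u) := by
  unfold weakGradient
  rw [dif_pos h]
  exact h.choose_spec

/-- The integrand of the weak formulation is integrable on compactly supported test functions. -/
theorem integrableOn_coord_mul_test {N : ℕ} {Ω : Set (RN N)} {G : RN N → RN N}
    (hG : LocallyIntegrableOn G Ω) {φ : RN N → ℝ} (hφ : IsTestFunction Ω φ) (i : Fin N) :
    IntegrableOn (fun x => G x i * φ x) Ω := by
  obtain ⟨h1, h2, h3⟩ := hφ
  have hK : IntegrableOn G (tsupport φ) := hG.integrableOn_compact_subset h3 h2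
  have hKi : IntegrableOn (fun x => G x i) (tsupport φ) :=
    (EuclideanSpace.proj (𝕜 := ℝ) i : RN N →L[ℝ] ℝ).integrable_comp hK
  have := hKi.mul_continuousOn h1.continuous.continuousOn h2
  refine Integrable.integrableOn ?_
  refine (integrableOn_iff_integrable_of_support_subset ?_).1 this
  intro x hx
  apply subset_tsupport φ
  intro h0
  exact hx (by simp [h0])

/-- Weak gradients in an open set are unique almost everywhere. -/
theorem IsWeakGradient.ae_eq {N : ℕ} {Ω : Set (RN N)} (hΩ : IsOpen Ω) {u v : RN N → ℝ}
    {G G' : RN N → RN N} (hG : IsWeakGradient Ω u G) (hG' : IsWeakGradient Ω v G')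
    (huv : u =ᵐ[volume.restrict Ω] v) : G =ᵐ[volume.restrict Ω] G' := by
  have key : ∀ i : Fin N, ∀ᵐ x, x ∈ Ω → G x i - G' x i = 0 := by
    intro i
    refine hΩ.ae_eq_zero_of_integral_contDiff_smul_eq_zero ?_ ?_
    · intro x hx
      have := (hG.2.1.sub hG'.2.1) x hx
      obtain ⟨s, hs, hi⟩ := this
      exact ⟨s, hs, (EuclideanSpace.proj (𝕜 := ℝ) i : RN N →L[ℝ] ℝ).integrable_comp hi⟩
    · intro g g1 g2 g3
      have hg : IsTestFunction Ω g := ⟨g1, g2, g3⟩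
      have e1 := hG.2.2 g hg i
      have e2 := hG'.2.2 g hg i
      have e3 : ∫ x in Ω, u x * gradient g x i = ∫ x in Ω, v x * gradient g x i := by
        refine integral_congr_ae ?_
        filter_upwards [huv] with x hx
        rw [hx]
      have e4 := integral_sub (integrableOn_coord_mul_test hG.2.1 hg i)
        (integrableOn_coord_mul_test hG'.2.1 hg i)
      have e5 : ∫ x, g x • (G x i - G' x i) = ∫ x in Ω, (G x i * g x - G' x i * g x) := by
        rw [setIntegral_eq_integral_of_forall_compl_eq_zero]
        · refine integral_congr_ae (Eventually.of_forall fun x => ?_)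
          simp only [smul_eq_mul]
          ring
        · intro x hx
          have : g x = 0 := image_eq_zero_of_notMem_tsupport fun h => hx (g3 h)
          simp [this]
      rw [e5, e4]
      linarith
  rw [Filter.EventuallyEq, ae_restrict_iff' hΩ.measurableSet]
  filter_upwards [ae_all_iff.2 key] with x hx hxΩ
  ext i
  exact sub_eq_zero.1 (hx i hxΩ)

/-!
The proof is by a common test function. Put `a = μ p / (p - 1)` and test both weak inequalities
with `φ = (exp (a u₁) - exp (a u₂))⁺`. On `{u₁ > u₂}`, with `ξ = ∇u₁`, `η = ∇u₂`,
`A = exp (a u₁)`, `B = exp (a u₂)`, the difference of the two left-hand sides minus the difference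
of the two gradient terms has the integrand
`a A (|ξ|^p / p + (p-1)/p |η|^p - |η|^(p-2) η·ξ) + a B (|η|^p / p + (p-1)/p |ξ|^p - |ξ|^(p-2) ξ·η)`
(`picone_identity`). Both brackets are nonnegative by Young's inequality, and vanish only for
`ξ = η` (`norm_rpow_mul_inner_lt`). The remaining term `(f(x,u₁) - f(x,u₂)) φ` has a nonpositive
integral because `f` is nonincreasing. Hence `∇u₁ = ∇u₂` almost everywhere on `{u₁ > u₂}`, that is,
`∇(u₁ - u₂)⁺ = 0`; as `(u₁ - u₂)⁺` is a nonnegative element of `W₀^{1,p}(Ω)`, it is zero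
(`MemSobolevZero.ae_eq_zero_of_gradient_eq_zero`).

The bulk of the file is the Sobolev calculus that makes `φ` admissible. Mollification converges in
`L^q` (`ContDiffBump.tendsto_eLpNorm_convolution_sub`), which gives the chain rule for `C^1`
functions (`IsWeakGradient.comp`) and, by smoothing, for the positive part
(`IsWeakGradient.posPart`). Membership in `W₀^{1,p}(Ω)` comes from the order structure: a function
of `W^{1,p}(Ω)` between `0` and an element of `W₀^{1,p}(Ω)` is in `W₀^{1,p}(Ω)`
(`MemSobolevZero.of_nonneg_of_le`). It applies because
`(u₁ - u₂)⁺ ≤ u₁⁺ + u₂⁻` and `φ ≤ C (u₁ - u₂)⁺`. No trace theorem is involved: the boundary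
condition enters only through `u₁⁺, u₂⁻ ∈ W₀^{1,p}(Ω)`, and the continuity of `u₁`, `u₂` gives their
boundedness and the passage from almost everywhere to everywhere.
-/

/-! ### Mollification in `L^q` -/

section Mollification

open scoped Convolution ENNReal
open ContinuousLinearMap (lsmul)

variable {E : Type*} [NormedAddCommGroup E] [NormedSpace ℝ E] [FiniteDimensional ℝ E]
  [MeasurableSpace E] [BorelSpace E] {F : Type*} [NormedAddCommGroup F]
  {m : Measure E} [m.IsAddHaarMeasure]

/-- Translations act continuously on `L^q`, `1 ≤ q < ∞`. -/
theorem MeasureTheory.MemLp.eventually_eLpNorm_translate_sub_le {q : ℝ≥0∞} (hq1 : 1 ≤ q)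
    (hq : q ≠ ⊤) {g : E → F} (hg : MemLp g q m) {ε : ℝ≥0∞} (hε : ε ≠ 0) :
    ∀ᶠ y in 𝓝 (0 : E), eLpNorm (fun x => g (x - y) - g x) q m ≤ ε := by
  have : Fact (1 ≤ q) := ⟨hq1⟩
  have hmp : ∀ y : E, MeasurePreserving (fun x : E => x - y) m m := fun y =>
    measurePreserving_sub_right m y
  let T : E → C(E, E) := fun y => ⟨fun x => x - y, by fun_prop⟩
  have hT : Continuous T :=
    ContinuousMap.continuous_of_continuous_uncurry _ (by
      change Continuous fun z : E × E => z.2 - z.1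
      fun_prop)
  have hcont : Continuous fun y => Lp.compMeasurePreserving (T y) (hmp y) (hg.toLp g) :=
    continuous_const.compMeasurePreservingLp hT hmp hq
  have h0 : Tendsto (fun y => edist (Lp.compMeasurePreserving (T y) (hmp y) (hg.toLp g))
      (Lp.compMeasurePreserving (T 0) (hmp 0) (hg.toLp g))) (𝓝 0) (𝓝 0) := by
    have := (hcont.edist (continuous_const (y := Lp.compMeasurePreserving (T 0) (hmp 0)
      (hg.toLp g)))).tendsto (0 : E)
    simpa only [edist_self] using this
  filter_upwards [(ENNReal.tendsto_nhds_zero.1 h0) ε (pos_iff_ne_zero.2 hε)] with y hy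
  rw [Lp.toLp_compMeasurePreserving, Lp.toLp_compMeasurePreserving, Lp.edist_toLp_toLp] at hy
  refine le_trans (le_of_eq ?_) hy
  congr 1
  ext x
  simp [T]

variable [NormedSpace ℝ F]

theorem ContDiffBump.isProbabilityMeasure_withDensity (ρ : ContDiffBump (0 : E)) :
    IsProbabilityMeasure (m.withDensity fun y => ENNReal.ofReal (ρ.normed m y)) := by
  constructor
  rw [withDensity_apply _ MeasurableSet.univ, Measure.restrict_univ,
    ← ofReal_integral_eq_lintegral_ofReal ρ.integrable_normed
      (Eventually.of_forall fun y => ρ.nonneg_normed y), ρ.integral_normed, ENNReal.ofReal_one]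

/-- Mollification moves a function in `L^q` by at most the supremum of the moves by translations
of the same size. By Jensen's inequality for the probability measure `ρ dy` and Tonelli. -/
theorem ContDiffBump.eLpNorm_convolution_sub_le [CompleteSpace F] (ρ : ContDiffBump (0 : E))
    {q : ℝ≥0∞} (hq1 : 1 ≤ q) (hq : q ≠ ⊤) {g : E → F} (hgm : StronglyMeasurable g)
    (hg : MemLp g q m) {ε : ℝ≥0∞}
    (hε : ∀ y ∈ Metric.ball (0 : E) ρ.rOut, eLpNorm (fun x => g (x - y) - g x) q m ≤ ε) :
    eLpNorm (ρ.normed m ⋆[lsmul ℝ ℝ, m] g - g) q m ≤ ε := by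
  have hq0 : q ≠ 0 := (one_pos.trans_le hq1).ne'
  have hqr : 0 < q.toReal := ENNReal.toReal_pos hq0 hq
  set ν : Measure E := m.withDensity fun y => ENNReal.ofReal (ρ.normed m y) with hν
  have : IsProbabilityMeasure ν := ρ.isProbabilityMeasure_withDensity
  have hρm : Measurable fun y => ENNReal.ofReal (ρ.normed m y) :=
    ρ.continuous_normed.measurable.ennreal_ofReal
  have hloc : LocallyIntegrable g m := hg.locallyIntegrable hq1
  have hdm : StronglyMeasurable (fun z : E × E => g (z.1 - z.2) - g z.1) :=
    (hgm.comp_measurable (measurable_fst.sub measurable_snd)).sub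
      (hgm.comp_measurable measurable_fst)
  have point : ∀ x, ‖(ρ.normed m ⋆[lsmul ℝ ℝ, m] g - g) x‖ₑ ^ q.toReal
      ≤ ∫⁻ y, ‖g (x - y) - g x‖ₑ ^ q.toReal ∂ν := by
    intro x
    have hex : ConvolutionExistsAt (ρ.normed m) g x (lsmul ℝ ℝ) m :=
      (ρ.hasCompactSupport_normed.convolutionExists_left (lsmul ℝ ℝ) ρ.continuous_normed hloc) x
    have h1 : (ρ.normed m ⋆[lsmul ℝ ℝ, m] g - g) x
        = ∫ y, ρ.normed m y • (g (x - y) - g x) ∂m := by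
      simp only [smul_sub]
      have hex' : Integrable (fun y => ρ.normed m y • g (x - y)) m := hex
      rw [integral_sub hex' (ρ.integrable_normed.smul_const _), integral_smul_const,
        ρ.integral_normed, one_smul]
      rfl
    have h2 : ‖(ρ.normed m ⋆[lsmul ℝ ℝ, m] g - g) x‖ₑ
        ≤ eLpNorm (fun y => g (x - y) - g x) 1 ν := by
      rw [h1]
      refine (enorm_integral_le_lintegral_enorm _).trans (le_of_eq ?_)
      rw [eLpNorm_one_eq_lintegral_enorm, hν,
        lintegral_withDensity_eq_lintegral_mul₀ hρm.aemeasurable]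
      · refine lintegral_congr fun y => ?_
        rw [enorm_smul, Real.enorm_of_nonneg (ρ.nonneg_normed y)]
        rfl
      · exact (hdm.comp_measurable measurable_prodMk_left).enorm.aemeasurable
    have h3 := h2.trans (eLpNorm_le_eLpNorm_of_exponent_le hq1
      (hdm.comp_measurable measurable_prodMk_left).aestronglyMeasurable)
    calc _ ≤ _ := ENNReal.rpow_le_rpow h3 hqr.le
      _ = _ := by
        rw [eLpNorm_eq_lintegral_rpow_enorm_toReal hq0 hq, ← ENNReal.rpow_mul,
          one_div_mul_cancel hqr.ne', ENNReal.rpow_one]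
  have hsupp : ∀ᵐ y ∂ν, y ∈ Metric.ball (0 : E) ρ.rOut := by
    rw [hν, ae_withDensity_iff hρm]
    refine Eventually.of_forall fun y hy => ?_
    rw [← ρ.support_normed_eq (μ := m)]
    intro h0
    exact hy (by rw [h0, ENNReal.ofReal_zero])
  have hswap : AEMeasurable (Function.uncurry fun x y => ‖g (x - y) - g x‖ₑ ^ q.toReal)
      (m.prod ν) := (hdm.enorm.pow_const _).aemeasurable
  have total : ∫⁻ x, ‖(ρ.normed m ⋆[lsmul ℝ ℝ, m] g - g) x‖ₑ ^ q.toReal ∂m ≤ ε ^ q.toReal := by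
    calc _ ≤ ∫⁻ x, ∫⁻ y, ‖g (x - y) - g x‖ₑ ^ q.toReal ∂ν ∂m := lintegral_mono point
      _ = ∫⁻ y, ∫⁻ x, ‖g (x - y) - g x‖ₑ ^ q.toReal ∂m ∂ν := lintegral_lintegral_swap hswap
      _ ≤ ∫⁻ _, ε ^ q.toReal ∂ν := by
        refine lintegral_mono_ae ?_
        filter_upwards [hsupp] with y hy
        have h1 := ENNReal.rpow_le_rpow (hε y hy) hqr.le
        rwa [eLpNorm_eq_lintegral_rpow_enorm_toReal hq0 hq, ← ENNReal.rpow_mul,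
          one_div_mul_cancel hqr.ne', ENNReal.rpow_one] at h1
      _ = ε ^ q.toReal := by simp
  calc _ = (∫⁻ x, ‖(ρ.normed m ⋆[lsmul ℝ ℝ, m] g - g) x‖ₑ ^ q.toReal ∂m) ^ (1 / q.toReal) :=
        eLpNorm_eq_lintegral_rpow_enorm_toReal hq0 hq
    _ ≤ (ε ^ q.toReal) ^ (1 / q.toReal) := ENNReal.rpow_le_rpow total (by positivity)
    _ = ε := by rw [← ENNReal.rpow_mul, mul_one_div_cancel hqr.ne', ENNReal.rpow_one]

/-- Mollifications converge in `L^q`, `1 ≤ q < ∞`. -/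
theorem ContDiffBump.tendsto_eLpNorm_convolution_sub [CompleteSpace F] {ι : Type*} {l : Filter ι}
    {ρ : ι → ContDiffBump (0 : E)} (hρ : Tendsto (fun i => (ρ i).rOut) l (𝓝 0))
    {q : ℝ≥0∞} (hq1 : 1 ≤ q) (hq : q ≠ ⊤) {g : E → F} (hg : MemLp g q m) :
    Tendsto (fun i => eLpNorm ((ρ i).normed m ⋆[lsmul ℝ ℝ, m] g - g) q m) l (𝓝 0) := by
  obtain ⟨g', hg'm, hgg'⟩ := hg.aestronglyMeasurable
  have hg' : MemLp g' q m := hg.ae_eq hgg'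
  refine ENNReal.tendsto_nhds_zero.2 fun ε hε => ?_
  obtain ⟨δ, hδ, h⟩ := Metric.eventually_nhds_iff_ball.1
    (hg'.eventually_eLpNorm_translate_sub_le hq1 hq hε.ne')
  filter_upwards [hρ.eventually (gt_mem_nhds hδ)] with i hi
  have h1 := (ρ i).eLpNorm_convolution_sub_le hq1 hq hg'm hg' fun y hy =>
    h y (Metric.ball_subset_ball hi.le hy)
  refine le_trans (le_of_eq (eLpNorm_congr_ae ?_)) h1
  rw [convolution_congr (lsmul ℝ ℝ) (EventuallyEq.refl _ _) hgg']
  exact (EventuallyEq.refl _ _).sub hgg'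

end Mollification

/-! ### Smooth approximation of weak gradients -/

section WeakGradientApproximation

open scoped Convolution ENNReal
open ContinuousLinearMap (lsmul)

variable {N : ℕ} {Ω : Set (RN N)}

theorem gradient_apply_eq_fderiv (f : RN N → ℝ) (x : RN N) (i : Fin N) :
    gradient f x i = fderiv ℝ f x (EuclideanSpace.single i 1) := by
  have h := InnerProductSpace.toDual_symm_apply (𝕜 := ℝ) (x := EuclideanSpace.single i (1 : ℝ))
    (y := fderiv ℝ f x)
  rw [← h, EuclideanSpace.inner_single_right]
  simp [gradient]

theorem continuous_gradient {f : RN N → ℝ} (hf : ContDiff ℝ 1 f) : Continuous (gradient f) :=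
  (InnerProductSpace.toDual ℝ (RN N)).symm.continuous.comp (hf.continuous_fderiv one_ne_zero)

theorem gradient_eq_zero_of_notMem_tsupport {f : RN N → ℝ} {x : RN N} (hx : x ∉ tsupport f) :
    gradient f x = 0 := by
  have : fderiv ℝ f x = 0 := by
    have h := (notMem_tsupport_iff_eventuallyEq.1 hx).fderiv_eq (𝕜 := ℝ)
    rw [h]
    simp
  simp [gradient, this]

/-- The derivative of a mollification falls on the reflected and translated kernel
`y ↦ ρ (x - y)`, which is the test function for the weak gradient. -/
theorem MeasureTheory.LocallyIntegrable.gradient_convolution_apply {ρ : RN N → ℝ}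
    (hρ : ContDiff ℝ 1 ρ) (hρc : HasCompactSupport ρ) {g : RN N → ℝ} (hg : LocallyIntegrable g) (x : RN N) (i : Fin N) :
    gradient (ρ ⋆[lsmul ℝ ℝ, volume] g) x i
      = - ∫ y, g y * gradient (fun z => ρ (x - z)) y i := by
  have hd := hρc.hasFDerivAt_convolution_left (lsmul ℝ ℝ) hρ hg x
  have hex : ConvolutionExistsAt (fderiv ℝ ρ) g x ((lsmul ℝ ℝ).precompL (RN N)) volume :=
    ((hρc.fderiv ℝ).convolutionExists_left _ (hρ.continuous_fderiv one_ne_zero) hg) x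
  rw [gradient_apply_eq_fderiv, hd.fderiv, convolution_def,
    ContinuousLinearMap.integral_apply hex]
  rw [← integral_neg, ← integral_sub_left_eq_self _ volume x]
  refine integral_congr_ae (Eventually.of_forall fun y => ?_)
  have h2 : gradient (fun z => ρ (x - z)) y i
      = - fderiv ℝ ρ (x - y) (EuclideanSpace.single i 1) := by
    rw [gradient_apply_eq_fderiv]
    have h3 : HasFDerivAt (fun z => ρ (x - z))
        ((fderiv ℝ ρ (x - y)).comp (-(ContinuousLinearMap.id ℝ (RN N)))) y :=
      ((hρ.differentiable one_ne_zero) (x - y)).hasFDerivAt.comp y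
        ((hasFDerivAt_id y).const_sub x)
    rw [h3.fderiv]
    simp
  simp only [h2]
  simp [ContinuousLinearMap.precompL_apply, mul_comm]

theorem isTestFunction_bump_sub (ρ : ContDiffBump (0 : RN N)) {x : RN N}
    (hx : Metric.closedBall x ρ.rOut ⊆ Ω) :
    IsTestFunction Ω (fun y => ρ.normed volume (x - y)) ∧
      tsupport (fun y => ρ.normed volume (x - y)) ⊆ Metric.closedBall x ρ.rOut := by
  have hs : tsupport (fun y => ρ.normed volume (x - y)) ⊆ Metric.closedBall x ρ.rOut := by
    refine closure_minimal ?_ Metric.isClosed_closedBall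
    intro y hy
    have : x - y ∈ Metric.ball (0 : RN N) ρ.rOut := by
      rw [← ρ.support_normed_eq (μ := volume)]
      exact hy
    rw [mem_ball_zero_iff] at this
    rw [Metric.mem_closedBall, dist_comm, dist_eq_norm]
    exact this.le
  refine ⟨⟨?_, ?_, hs.trans hx⟩, hs⟩
  · exact (ρ.contDiff_normed (n := ⊤)).comp (contDiff_const.sub contDiff_id)
  · exact HasCompactSupport.of_support_subset_isCompact (isCompact_closedBall x ρ.rOut)
      ((subset_tsupport _).trans hs)

/-- Away from the boundary of a compact set `L ⊆ Ω`, mollifying `u` cut off to `L` mollifies its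
weak gradient. -/
theorem IsWeakGradient.gradient_convolution {u : RN N → ℝ} {G : RN N → RN N}
    (h : IsWeakGradient Ω u G) {L : Set (RN N)} (hL : IsCompact L) (hLΩ : L ⊆ Ω)
    (ρ : ContDiffBump (0 : RN N)) {x : RN N} (hx : Metric.closedBall x ρ.rOut ⊆ L) :
    gradient (ρ.normed volume ⋆[lsmul ℝ ℝ, volume] L.indicator u) x
      = (ρ.normed volume ⋆[lsmul ℝ ℝ, volume] L.indicator G) x := by
  have hu : Integrable (L.indicator u) :=
    (h.1.integrableOn_compact_subset hLΩ hL).integrable_indicator hL.measurableSet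
  have hG : Integrable (L.indicator G) :=
    (h.2.1.integrableOn_compact_subset hLΩ hL).integrable_indicator hL.measurableSet
  obtain ⟨hφ, hφs⟩ := isTestFunction_bump_sub ρ (hx.trans hLΩ)
  ext i
  rw [MeasureTheory.LocallyIntegrable.gradient_convolution_apply (ρ.contDiff_normed (n := 1))
    ρ.hasCompactSupport_normed hu.locallyIntegrable x i]
  have e1 : ∫ y, L.indicator u y * gradient (fun z => ρ.normed volume (x - z)) y i
      = ∫ y in Ω, u y * gradient (fun z => ρ.normed volume (x - z)) y i := by
    rw [← setIntegral_eq_integral_of_forall_compl_eq_zero (s := Ω)]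
    · refine integral_congr_ae (Eventually.of_forall fun y => ?_)
      by_cases hy : y ∈ L
      · simp [hy]
      · have := gradient_eq_zero_of_notMem_tsupport (fun h' => hy (hx (hφs h')))
        simp [this]
    · intro y hy
      simp [Set.indicator_of_notMem (fun h' => hy (hLΩ h'))]
  have hex : ConvolutionExistsAt (ρ.normed volume) (L.indicator G) x (lsmul ℝ ℝ) volume :=
    (ρ.hasCompactSupport_normed.convolutionExists_left (lsmul ℝ ℝ) ρ.continuous_normed
      hG.locallyIntegrable) x
  have e2 : (ρ.normed volume ⋆[lsmul ℝ ℝ, volume] L.indicator G) x i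
      = ∫ y in Ω, G y i * ρ.normed volume (x - y) := by
    have e3 := (EuclideanSpace.proj (𝕜 := ℝ) i : RN N →L[ℝ] ℝ).integral_comp_comm hex
    change (EuclideanSpace.proj (𝕜 := ℝ) i : RN N →L[ℝ] ℝ) _ = _
    rw [convolution_def, ← e3, ← integral_sub_left_eq_self _ volume x,
      ← setIntegral_eq_integral_of_forall_compl_eq_zero (s := Ω)]
    · refine integral_congr_ae (Eventually.of_forall fun y => ?_)
      by_cases hy : y ∈ L
      · simp [hy, mul_comm]
      · have : ρ.normed volume (x - y) = 0 :=
          image_eq_zero_of_notMem_tsupport (f := fun z => ρ.normed volume (x - z))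
            (fun h' => hy (hx (hφs h')))
        simp [this]
    · intro y hy
      simp [Set.indicator_of_notMem (fun h' => hy (hLΩ h'))]
  rw [e1, e2, h.2.2 _ hφ i, neg_neg]

/-- Bumps shrinking to the origin. -/
noncomputable def shrinkingBump (N : ℕ) (n : ℕ) : ContDiffBump (0 : RN N) where
  rIn := 1 / (2 * ((n : ℝ) + 1))
  rOut := 1 / ((n : ℝ) + 1)
  rIn_pos := by positivity
  rIn_lt_rOut := by
    apply one_div_lt_one_div_of_lt <;> [positivity; linarith [(n.cast_nonneg : (0 : ℝ) ≤ n)]]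

theorem tendsto_shrinkingBump_rOut :
    Tendsto (fun n => (shrinkingBump N n).rOut) atTop (𝓝 0) :=
  tendsto_one_div_add_atTop_nhds_zero_nat

/-- On a compact subset of `Ω`, a function and its weak gradient are limits in `L^1` of smooth
functions and their gradients. -/
theorem IsWeakGradient.exists_smooth_approx (hΩ : IsOpen Ω) {u : RN N → ℝ} {G : RN N → RN N}
    (h : IsWeakGradient Ω u G) {K : Set (RN N)} (hK : IsCompact K) (hKΩ : K ⊆ Ω) :
    ∃ v : ℕ → RN N → ℝ, (∀ n, ContDiff ℝ ∞ (v n)) ∧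
      Tendsto (fun n => eLpNorm (v n - u) 1 (volume.restrict K)) atTop (𝓝 0) ∧
      Tendsto (fun n => eLpNorm (gradient (v n) - G) 1 (volume.restrict K)) atTop (𝓝 0) := by
  obtain ⟨δ, hδ, hδΩ⟩ := hK.exists_cthickening_subset_open hΩ hKΩ
  set L := Metric.cthickening δ K with hL
  have hLc : IsCompact L := hK.cthickening
  have hKL : K ⊆ L := Metric.self_subset_cthickening K
  have hu : Integrable (L.indicator u) :=
    (h.1.integrableOn_compact_subset hδΩ hLc).integrable_indicator hLc.measurableSet
  have hG : Integrable (L.indicator G) :=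
    (h.2.1.integrableOn_compact_subset hδΩ hLc).integrable_indicator hLc.measurableSet
  have hev : ∀ᶠ n in atTop, (shrinkingBump N n).rOut ≤ δ :=
    (tendsto_shrinkingBump_rOut.eventually (gt_mem_nhds hδ)).mono fun n hn => le_of_lt hn
  refine ⟨fun n => (shrinkingBump N n).normed volume ⋆[lsmul ℝ ℝ, volume] L.indicator u,
    fun n => (shrinkingBump N n).hasCompactSupport_normed.contDiff_convolution_left _
      ((shrinkingBump N n).contDiff_normed (n := ⊤)) hu.locallyIntegrable, ?_, ?_⟩
  · refine tendsto_of_tendsto_of_tendsto_of_le_of_le tendsto_const_nhds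
      (ContDiffBump.tendsto_eLpNorm_convolution_sub tendsto_shrinkingBump_rOut le_rfl
        ENNReal.one_ne_top (memLp_one_iff_integrable.2 hu)) (fun _ => zero_le) fun n => ?_
    refine le_trans (le_of_eq ?_) (eLpNorm_restrict_le _ _ _ K)
    refine eLpNorm_congr_ae ?_
    filter_upwards [ae_restrict_mem hK.measurableSet] with x hx
    simp [hKL hx]
  · refine tendsto_of_tendsto_of_tendsto_of_le_of_le' tendsto_const_nhds
      (ContDiffBump.tendsto_eLpNorm_convolution_sub tendsto_shrinkingBump_rOut le_rfl
        ENNReal.one_ne_top (memLp_one_iff_integrable.2 hG)) (Eventually.of_forall fun _ => zero_le) ?_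
    filter_upwards [hev] with n hn
    refine le_trans (le_of_eq ?_) (eLpNorm_restrict_le _ _ _ K)
    refine eLpNorm_congr_ae ?_
    filter_upwards [ae_restrict_mem hK.measurableSet] with x hx
    have hb : Metric.closedBall x (shrinkingBump N n).rOut ⊆ L :=
      (Metric.closedBall_subset_closedBall hn).trans (Metric.closedBall_subset_cthickening hx δ)
    simp [hKL hx, h.gradient_convolution hLc hδΩ _ hb]

end WeakGradientApproximation

/-! ### Convergence in `L^q` -/

section ConvergenceTools

open scoped ENNReal

variable {α : Type*} {mα : MeasurableSpace α} {m : Measure α} {F : Type*} [NormedAddCommGroup F]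

/-- Dominated convergence in `L^q`, `0 < q < ∞`. -/
theorem tendsto_eLpNorm_zero_of_dominated {q : ℝ≥0∞} (hq0 : q ≠ 0) (hq : q ≠ ⊤)
    {f : ℕ → α → F} {b : α → ℝ} (hf : ∀ n, AEStronglyMeasurable (f n) m) (hb : MemLp b q m)
    (hfb : ∀ n, ∀ᵐ x ∂m, ‖f n x‖ ≤ b x) (hlim : ∀ᵐ x ∂m, Tendsto (fun n => f n x) atTop (𝓝 0)) :
    Tendsto (fun n => eLpNorm (f n) q m) atTop (𝓝 0) := by
  have hqr : 0 < q.toReal := ENNReal.toReal_pos hq0 hq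
  have h1 : Tendsto (fun n => ∫⁻ x, ‖f n x‖ₑ ^ q.toReal ∂m) atTop (𝓝 (∫⁻ _, 0 ∂m)) := by
    refine tendsto_lintegral_of_dominated_convergence' (fun x => ‖b x‖ₑ ^ q.toReal)
      (fun n => (hf n).enorm.pow_const _) (fun n => ?_) ?_ ?_
    · filter_upwards [hfb n] with x hx
      refine ENNReal.rpow_le_rpow ?_ hqr.le
      exact enorm_le_iff_norm_le.2 (hx.trans (le_abs_self _))
    · exact (lintegral_rpow_enorm_lt_top_of_eLpNorm_lt_top hq0 hq hb.2).ne
    · filter_upwards [hlim] with x hx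
      have := ((ENNReal.continuous_rpow_const (y := q.toReal)).tendsto _).comp hx.enorm
      simpa [Function.comp_def, hqr] using this
  have h2 := ((ENNReal.continuous_rpow_const (y := 1 / q.toReal)).tendsto _).comp h1
  simp only [lintegral_zero, ENNReal.zero_rpow_of_pos (one_div_pos.2 hqr)] at h2
  refine h2.congr fun n => ?_
  rw [eLpNorm_eq_lintegral_rpow_enorm_toReal hq0 hq]
  rfl

/-- Convergence in `L^1` can be tested against bounded functions. -/
theorem tendsto_integral_mul_of_tendsto_eLpNorm_one {f : ℕ → α → ℝ} {g ψ : α → ℝ} {C : ℝ}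
    (hf : ∀ n, Integrable (f n) m) (hg : Integrable g m) (hψ : AEStronglyMeasurable ψ m)
    (hC : ∀ᵐ x ∂m, ‖ψ x‖ ≤ C) (h : Tendsto (fun n => eLpNorm (f n - g) 1 m) atTop (𝓝 0)) :
    Tendsto (fun n => ∫ x, f n x * ψ x ∂m) atTop (𝓝 (∫ x, g x * ψ x ∂m)) := by
  refine tendsto_integral_of_L1 _ (hg.mul_bdd hψ hC).aestronglyMeasurable
    (Eventually.of_forall fun n => (hf n).mul_bdd hψ hC) ?_
  have h1 : Tendsto (fun n => ENNReal.ofReal C * eLpNorm (f n - g) 1 m) atTop (𝓝 0) := by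
    simpa using ENNReal.Tendsto.const_mul h (Or.inr ENNReal.ofReal_ne_top)
  refine tendsto_of_tendsto_of_tendsto_of_le_of_le tendsto_const_nhds h1
    (fun _ => zero_le) fun n => ?_
  simp only
  rw [← eLpNorm_one_eq_lintegral_enorm]
  refine eLpNorm_le_mul_eLpNorm_of_ae_le_mul (hC.mono fun x hx => ?_) 1
  rw [← sub_mul, norm_mul, mul_comm]
  exact mul_le_mul_of_nonneg_right hx (norm_nonneg _)

theorem MeasureTheory.LocallyIntegrableOn.of_norm_le {X : Type*} [TopologicalSpace X]
    [MeasurableSpace X] {μ : Measure X} {s : Set X} {F' : Type*} [NormedAddCommGroup F']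
    {f : X → F} {g : X → F'} (hf : LocallyIntegrableOn f s μ)
    (hg : AEStronglyMeasurable g (μ.restrict s)) (h : ∀ x ∈ s, ‖g x‖ ≤ ‖f x‖)
    (hs : MeasurableSet s) :
    LocallyIntegrableOn g s μ := by
  intro x hx
  obtain ⟨t, ht, hi⟩ := hf x hx
  refine ⟨s ∩ t, inter_mem self_mem_nhdsWithin ht, ?_⟩
  refine Integrable.mono (hi.mono_set Set.inter_subset_right) (hg.mono_set Set.inter_subset_left) ?_
  exact ae_restrict_of_ae_restrict_of_subset Set.inter_subset_left
    ((ae_restrict_iff' hs).2 (Eventually.of_forall h))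

end ConvergenceTools

/-! ### Calculus of weak gradients -/

section WeakGradientCalculus

open scoped ENNReal

variable {N : ℕ} {Ω : Set (RN N)}

theorem IsTestFunction.contDiff_one {φ : RN N → ℝ} (hφ : IsTestFunction Ω φ) : ContDiff ℝ 1 φ :=
  hφ.1.of_le (by norm_num)

theorem IsTestFunction.continuous_gradient_apply {φ : RN N → ℝ} (hφ : IsTestFunction Ω φ)
    (i : Fin N) : Continuous fun x => gradient φ x i :=
  (EuclideanSpace.proj (𝕜 := ℝ) i : RN N →L[ℝ] ℝ).continuous.comp
    (continuous_gradient hφ.contDiff_one)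

theorem IsTestFunction.exists_bound {φ : RN N → ℝ} (hφ : IsTestFunction Ω φ) (i : Fin N) :
    ∃ C, (∀ x, ‖φ x‖ ≤ C) ∧ ∀ x, ‖gradient φ x i‖ ≤ C := by
  obtain ⟨C, hC⟩ := hφ.2.1.exists_bound_of_continuous hφ.1.continuous
  have hs : HasCompactSupport fun x => gradient φ x i :=
    hφ.2.1.mono' fun x hx => by
      by_contra h
      exact hx (by simp [gradient_eq_zero_of_notMem_tsupport h])
  obtain ⟨C', hC'⟩ := hs.exists_bound_of_continuous (hφ.continuous_gradient_apply i)
  exact ⟨max C C', fun x => (hC x).trans (le_max_left _ _), fun x => (hC' x).trans (le_max_right _ _)⟩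

theorem IsWeakGradient.mono {Ω' : Set (RN N)} (hΩ : MeasurableSet Ω) (hΩ' : Ω' ⊆ Ω) {u : RN N → ℝ}
    {G : RN N → RN N} (h : IsWeakGradient Ω u G) : IsWeakGradient Ω' u G := by
  refine ⟨h.1.mono_set hΩ', h.2.1.mono_set hΩ', fun φ hφ i => ?_⟩
  have h1 := h.2.2 φ ⟨hφ.1, hφ.2.1, hφ.2.2.trans hΩ'⟩ i
  rwa [setIntegral_eq_of_subset_of_forall_sdiff_eq_zero hΩ hΩ',
    setIntegral_eq_of_subset_of_forall_sdiff_eq_zero hΩ hΩ'] at h1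
  · intro x hx
    have : x ∉ tsupport φ := fun h => hx.2 (hφ.2.2 h)
    simp [image_eq_zero_of_notMem_tsupport this]
  · intro x hx
    have : x ∉ tsupport φ := fun h => hx.2 (hφ.2.2 h)
    simp [gradient_eq_zero_of_notMem_tsupport this]

theorem IsWeakGradient.congr_ae {u v : RN N → ℝ} {G G' : RN N → RN N}
    (h : IsWeakGradient Ω u G) (huv : u =ᵐ[volume.restrict Ω] v)
    (hG : G =ᵐ[volume.restrict Ω] G') : IsWeakGradient Ω v G' := by
  refine ⟨h.1.congr huv, h.2.1.congr hG, fun φ hφ i => ?_⟩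
  have e1 : ∫ x in Ω, v x * gradient φ x i = ∫ x in Ω, u x * gradient φ x i :=
    integral_congr_ae (huv.mono fun x hx => by simp only [hx])
  have e2 : ∫ x in Ω, G' x i * φ x = ∫ x in Ω, G x i * φ x :=
    integral_congr_ae (hG.mono fun x hx => by simp only [hx])
  rw [e1, e2, h.2.2 φ hφ i]

theorem integrableOn_mul_gradient_test {u : RN N → ℝ} (hu : LocallyIntegrableOn u Ω)
    {φ : RN N → ℝ} (hφ : IsTestFunction Ω φ) (i : Fin N) :
    IntegrableOn (fun x => u x * gradient φ x i) Ω := by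
  have hK : IntegrableOn u (tsupport φ) := hu.integrableOn_compact_subset hφ.2.2 hφ.2.1
  have h1 := hK.mul_continuousOn (hφ.continuous_gradient_apply i).continuousOn hφ.2.1
  refine ((integrableOn_iff_integrable_of_support_subset fun x hx => ?_).1 h1).integrableOn
  by_contra h
  exact hx (by simp [gradient_eq_zero_of_notMem_tsupport h])

theorem IsWeakGradient.add {u v : RN N → ℝ} {G G' : RN N → RN N} (h : IsWeakGradient Ω u G)
    (h' : IsWeakGradient Ω v G') :
    IsWeakGradient Ω (fun x => u x + v x) (fun x => G x + G' x) := by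
  refine ⟨h.1.add h'.1, h.2.1.add h'.2.1, fun φ hφ i => ?_⟩
  have e1 := integral_add (integrableOn_mul_gradient_test h.1 hφ i)
    (integrableOn_mul_gradient_test h'.1 hφ i)
  have e2 := integral_add (integrableOn_coord_mul_test h.2.1 hφ i)
    (integrableOn_coord_mul_test h'.2.1 hφ i)
  simp only [add_mul, PiLp.add_apply] at e1 e2 ⊢
  rw [e1, e2, h.2.2 φ hφ i, h'.2.2 φ hφ i]
  ring

theorem IsWeakGradient.const_mul {u : RN N → ℝ} {G : RN N → RN N} (h : IsWeakGradient Ω u G)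
    (c : ℝ) : IsWeakGradient Ω (fun x => c * u x) (fun x => c • G x) := by
  refine ⟨h.1.smul c, h.2.1.smul c, fun φ hφ i => ?_⟩
  simp only [PiLp.smul_apply, smul_eq_mul, mul_assoc, integral_const_mul]
  rw [h.2.2 φ hφ i]
  ring

theorem IsWeakGradient.neg {u : RN N → ℝ} {G : RN N → RN N} (h : IsWeakGradient Ω u G) :
    IsWeakGradient Ω (fun x => - u x) (fun x => - G x) := by
  simpa using h.const_mul (-1)

theorem IsWeakGradient.sub {u v : RN N → ℝ} {G G' : RN N → RN N} (h : IsWeakGradient Ω u G)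
    (h' : IsWeakGradient Ω v G') :
    IsWeakGradient Ω (fun x => u x - v x) (fun x => G x - G' x) := by
  simpa only [sub_eq_add_neg] using h.add h'.neg

theorem isWeakGradient_zero : IsWeakGradient Ω (fun _ => 0) (fun _ => 0) :=
  ⟨locallyIntegrableOn_zero, locallyIntegrableOn_zero, fun φ _ i => by simp⟩

/-- The classical gradient of a `C^1` function is its weak gradient. -/
theorem isWeakGradient_gradient (hΩ : MeasurableSet Ω) {v : RN N → ℝ} (hv : ContDiff ℝ 1 v) :
    IsWeakGradient Ω v (gradient v) := by
  refine ⟨hv.continuous.continuousOn.locallyIntegrableOn hΩ,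
    (continuous_gradient hv).continuousOn.locallyIntegrableOn hΩ, fun φ hφ i => ?_⟩
  rw [setIntegral_eq_integral_of_forall_compl_eq_zero,
    setIntegral_eq_integral_of_forall_compl_eq_zero]
  · simp only [gradient_apply_eq_fderiv]
    have hφd : Continuous fun x => fderiv ℝ φ x (EuclideanSpace.single i 1) :=
      (hφ.contDiff_one.continuous_fderiv one_ne_zero).clm_apply continuous_const
    have hvd : Continuous fun x => fderiv ℝ v x (EuclideanSpace.single i 1) :=
      (hv.continuous_fderiv one_ne_zero).clm_apply continuous_const
    refine integral_mul_fderiv_eq_neg_fderiv_mul_of_integrable ?_ ?_ ?_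
      (fun x _ => (hv.differentiable one_ne_zero) x)
      (fun x _ => (hφ.contDiff_one.differentiable one_ne_zero) x)
    · exact (hvd.mul hφ.1.continuous).integrable_of_hasCompactSupport hφ.2.1.mul_left
    · exact (hv.continuous.mul hφd).integrable_of_hasCompactSupport
        (hφ.2.1.fderiv_apply ℝ _).mul_left
    · exact (hv.continuous.mul hφ.1.continuous).integrable_of_hasCompactSupport hφ.2.1.mul_left
  · intro x hx
    have : x ∉ tsupport φ := fun h => hx (hφ.2.2 h)
    simp [image_eq_zero_of_notMem_tsupport this]
  · intro x hx
    have : x ∉ tsupport φ := fun h => hx (hφ.2.2 h)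
    simp [gradient_eq_zero_of_notMem_tsupport this]

/-- Weak gradients are stable under `L^1` limits on compact sets. The approximating sequence may
depend on the compact set. -/
theorem IsWeakGradient.of_approx (hΩ : MeasurableSet Ω) {u : RN N → ℝ} {G : RN N → RN N}
    (hu : LocallyIntegrableOn u Ω) (hG : LocallyIntegrableOn G Ω)
    (H : ∀ K : Set (RN N), IsCompact K → K ⊆ Ω → ∃ (v : ℕ → RN N → ℝ) (V : ℕ → RN N → RN N),
      (∀ n, IsWeakGradient Ω (v n) (V n)) ∧
      Tendsto (fun n => eLpNorm (v n - u) 1 (volume.restrict K)) atTop (𝓝 0) ∧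
      Tendsto (fun n => eLpNorm (V n - G) 1 (volume.restrict K)) atTop (𝓝 0)) :
    IsWeakGradient Ω u G := by
  refine ⟨hu, hG, fun φ hφ i => ?_⟩
  obtain ⟨v, V, hvV, hv, hV⟩ := H _ hφ.2.1 hφ.2.2
  obtain ⟨C, hC, hC'⟩ := hφ.exists_bound i
  let P : RN N →L[ℝ] ℝ := EuclideanSpace.proj (𝕜 := ℝ) i
  have onK : ∀ g : RN N → ℝ, ∫ x in Ω, g x * gradient φ x i
      = ∫ x in tsupport φ, g x * gradient φ x i := fun g =>
    setIntegral_eq_of_subset_of_forall_sdiff_eq_zero hΩ hφ.2.2 fun x hx => by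
      simp [gradient_eq_zero_of_notMem_tsupport hx.2]
  have onK' : ∀ g : RN N → ℝ, ∫ x in Ω, g x * φ x = ∫ x in tsupport φ, g x * φ x := fun g =>
    setIntegral_eq_of_subset_of_forall_sdiff_eq_zero hΩ hφ.2.2 fun x hx => by
      simp [image_eq_zero_of_notMem_tsupport hx.2]
  have l1 := tendsto_integral_mul_of_tendsto_eLpNorm_one
    (fun n => (hvV n).1.integrableOn_compact_subset hφ.2.2 hφ.2.1)
    (hu.integrableOn_compact_subset hφ.2.2 hφ.2.1)
    (hφ.continuous_gradient_apply i).aestronglyMeasurable (Eventually.of_forall hC') hv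
  have hVi : Tendsto (fun n => eLpNorm ((fun x => V n x i) - fun x => G x i) 1
      (volume.restrict (tsupport φ))) atTop (𝓝 0) := by
    refine tendsto_of_tendsto_of_tendsto_of_le_of_le tendsto_const_nhds hV (fun _ => zero_le)
      fun n => eLpNorm_mono fun x => ?_
    exact PiLp.norm_apply_le (V n x - G x) i
  have l2 := tendsto_integral_mul_of_tendsto_eLpNorm_one
    (fun n => P.integrable_comp ((hvV n).2.1.integrableOn_compact_subset hφ.2.2 hφ.2.1))
    (P.integrable_comp (hG.integrableOn_compact_subset hφ.2.2 hφ.2.1))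
    hφ.1.continuous.aestronglyMeasurable (Eventually.of_forall hC) hVi
  rw [onK, onK' fun x => G x i]
  refine tendsto_nhds_unique l1 (l2.neg.congr fun n => ?_)
  have h1 := (hvV n).2.2 φ hφ i
  rw [onK, onK' fun x => V n x i] at h1
  exact h1.symm

theorem gradient_comp {h h' : ℝ → ℝ} (hh : ∀ s, HasDerivAt h (h' s) s) {v : RN N → ℝ}
    (hv : Differentiable ℝ v) (x : RN N) :
    gradient (fun y => h (v y)) x = h' (v x) • gradient v x := by
  have h1 : HasFDerivAt (fun y => h (v y)) (h' (v x) • fderiv ℝ v x) x :=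
    (hh (v x)).comp_hasFDerivAt x (hv x).hasFDerivAt
  simp [gradient, h1.fderiv]

/-- Chain rule for a `C^1` function with bounded derivative, by smooth approximation of `u` in
`L^1` on compact sets. -/
theorem IsWeakGradient.comp (hΩ : IsOpen Ω) {u : RN N → ℝ} {G : RN N → RN N}
    (h : IsWeakGradient Ω u G) {η η' : ℝ → ℝ} (hη : ∀ s, HasDerivAt η (η' s) s)
    (hη' : Continuous η') {C : ℝ} (hC : ∀ s, ‖η' s‖ ≤ C) :
    IsWeakGradient Ω (fun x => η (u x)) (fun x => η' (u x) • G x) := by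
  have hηc : ContDiff ℝ 1 η := by
    rw [contDiff_one_iff_deriv]
    refine ⟨fun s => (hη s).differentiableAt, ?_⟩
    rwa [show deriv η = η' from funext fun s => (hη s).deriv]
  have hC0 : 0 ≤ C := (norm_nonneg _).trans (hC 0)
  have hlip : ∀ s t, ‖η s - η t‖ ≤ C * ‖s - t‖ := fun s t =>
    Convex.norm_image_sub_le_of_norm_hasDerivWithin_le (fun x _ => (hη x).hasDerivWithinAt)
      (fun x _ => hC x) convex_univ (Set.mem_univ t) (Set.mem_univ s)
  have hum := h.1.aestronglyMeasurable
  have hGm := h.2.1.aestronglyMeasurable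
  have hηu : LocallyIntegrableOn (fun x => η (u x)) Ω := by
    refine ((locallyIntegrableOn_const |η 0|).add (h.1.norm.smul C)).of_norm_le
      (hηc.continuous.comp_aestronglyMeasurable hum) (fun x _ => ?_) hΩ.measurableSet
    have h1 := hlip (u x) 0
    have h2 : ‖η (u x)‖ ≤ |η 0| + C * ‖u x‖ := by
      rw [sub_zero] at h1
      have := norm_add_le (η 0) (η (u x) - η 0)
      rw [add_sub_cancel] at this
      rw [← Real.norm_eq_abs]
      linarith
    exact h2.trans (le_abs_self _)
  have hηG : LocallyIntegrableOn (fun x => η' (u x) • G x) Ω := by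
    refine (h.2.1.smul C).of_norm_le
      ((hη'.comp_aestronglyMeasurable hum).smul hGm) (fun x _ => ?_) hΩ.measurableSet
    rw [Pi.smul_apply, norm_smul, norm_smul, Real.norm_of_nonneg hC0]
    exact mul_le_mul_of_nonneg_right (hC _) (norm_nonneg _)
  refine .of_approx hΩ.measurableSet hηu hηG fun K hK hKΩ => ?_
  obtain ⟨v, hv, hvu, hvG⟩ := h.exists_smooth_approx hΩ hK hKΩ
  have huK := h.1.integrableOn_compact_subset hKΩ hK
  have hGK := h.2.1.integrableOn_compact_subset hKΩ hK
  have hv1 : ∀ n, ContDiff ℝ 1 (v n) := fun n => (hv n).of_le (by norm_num)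
  obtain ⟨ns, hns, hae⟩ := (tendstoInMeasure_of_tendsto_eLpNorm one_ne_zero
    (fun n => (hv n).continuous.aestronglyMeasurable) huK.aestronglyMeasurable
    hvu).exists_seq_tendsto_ae
  refine ⟨fun n x => η (v (ns n) x), fun n x => η' (v (ns n) x) • gradient (v (ns n)) x,
    fun n => ?_, ?_, ?_⟩
  · have := isWeakGradient_gradient hΩ.measurableSet (hηc.comp (hv1 (ns n)))
    rwa [show gradient (η ∘ v (ns n)) = _ from
      funext fun x => gradient_comp hη ((hv1 (ns n)).differentiable one_ne_zero) x] at this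
  · have h1 : Tendsto (fun n => ENNReal.ofReal C * eLpNorm (v (ns n) - u) 1 (volume.restrict K))
        atTop (𝓝 0) := by
      simpa using ENNReal.Tendsto.const_mul (hvu.comp hns.tendsto_atTop)
        (Or.inr ENNReal.ofReal_ne_top)
    exact tendsto_of_tendsto_of_tendsto_of_le_of_le tendsto_const_nhds h1 (fun _ => zero_le)
      fun n => eLpNorm_le_mul_eLpNorm_of_ae_le_mul (Eventually.of_forall fun x => hlip _ _) 1
  · have h1 : Tendsto (fun n => ENNReal.ofReal C *
        eLpNorm (gradient (v (ns n)) - G) 1 (volume.restrict K)) atTop (𝓝 0) := by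
      simpa using ENNReal.Tendsto.const_mul (hvG.comp hns.tendsto_atTop)
        (Or.inr ENNReal.ofReal_ne_top)
    have h2 : Tendsto (fun n => eLpNorm (fun x => (η' (v (ns n) x) - η' (u x)) • G x) 1
        (volume.restrict K)) atTop (𝓝 0) := by
      refine tendsto_eLpNorm_zero_of_dominated one_ne_zero ENNReal.one_ne_top
        (b := fun x => 2 * C * ‖G x‖) (fun n => ?_) ?_ (fun n => ?_) ?_
      · exact ((hη'.comp (hv _).continuous).aestronglyMeasurable.sub
          (hη'.comp_aestronglyMeasurable huK.aestronglyMeasurable)).smul hGK.aestronglyMeasurable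
      · exact memLp_one_iff_integrable.2 (hGK.norm.const_mul _)
      · refine Eventually.of_forall fun x => ?_
        rw [norm_smul]
        refine mul_le_mul_of_nonneg_right ((norm_sub_le _ _).trans ?_) (norm_nonneg _)
        linarith [hC (v (ns n) x), hC (u x)]
      · filter_upwards [hae] with x hx
        have h3 := (((hη'.tendsto _).comp hx).sub_const (η' (u x))).smul_const (G x)
        simpa using h3
    have h3 := h1.add h2
    rw [add_zero] at h3
    refine tendsto_of_tendsto_of_tendsto_of_le_of_le tendsto_const_nhds h3 (fun _ => zero_le)
      fun n => ?_
    have hm1 : AEStronglyMeasurable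
        (fun x => η' (v (ns n) x) • (gradient (v (ns n)) x - G x)) (volume.restrict K) :=
      (hη'.comp (hv _).continuous).aestronglyMeasurable.smul
        ((continuous_gradient (hv1 _)).aestronglyMeasurable.sub hGK.aestronglyMeasurable)
    have hm2 : AEStronglyMeasurable (fun x => (η' (v (ns n) x) - η' (u x)) • G x)
        (volume.restrict K) :=
      ((hη'.comp (hv _).continuous).aestronglyMeasurable.sub
          (hη'.comp_aestronglyMeasurable huK.aestronglyMeasurable)).smul hGK.aestronglyMeasurable
    have e : ((fun x => η' (v (ns n) x) • gradient (v (ns n)) x) - fun x => η' (u x) • G x)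
        = (fun x => η' (v (ns n) x) • (gradient (v (ns n)) x - G x)) +
          fun x => (η' (v (ns n) x) - η' (u x)) • G x := by
      ext1 x
      simp only [Pi.sub_apply, Pi.add_apply]
      module
    simp only [e]
    refine (eLpNorm_add_le hm1 hm2 le_rfl).trans (add_le_add ?_ le_rfl)
    refine eLpNorm_le_mul_eLpNorm_of_ae_le_mul (Eventually.of_forall fun x => ?_) 1
    rw [norm_smul]
    exact mul_le_mul_of_nonneg_right (hC _) (norm_nonneg _)

end WeakGradientCalculus

/-! ### Positive parts and level sets -/

section Truncation

open scoped ENNReal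

variable {N : ℕ} {Ω : Set (RN N)}

/-- The derivative at `s` of the approximation `s ↦ (s + √((s - ε)² + ε⁴)) / 2` of the positive
part. -/
noncomputable def smoothStep (ε s : ℝ) : ℝ := (1 + (s - ε) / √((s - ε) ^ 2 + ε ^ 4)) / 2

theorem hasDerivAt_smoothPosPart {ε : ℝ} (hε : 0 < ε) (s : ℝ) :
    HasDerivAt (fun s => (s + √((s - ε) ^ 2 + ε ^ 4)) / 2) (smoothStep ε s) s := by
  have hpos : 0 < (s - ε) ^ 2 + ε ^ 4 := by positivity
  have h1 : HasDerivAt (fun s => (s - ε) ^ 2 + ε ^ 4) (2 * (s - ε)) s := by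
    simpa using (((hasDerivAt_id s).sub_const ε).pow 2).add_const (ε ^ 4)
  have h2 := ((hasDerivAt_id s).add (h1.sqrt hpos.ne')).div_const 2
  refine h2.congr_deriv ?_
  rw [smoothStep, mul_div_mul_left _ _ two_ne_zero]

theorem continuous_smoothStep {ε : ℝ} (hε : 0 < ε) : Continuous (smoothStep ε) := by
  unfold smoothStep
  refine (continuous_const.add (Continuous.div (by fun_prop) (by fun_prop) fun s => ?_)).div_const 2
  have hpos : 0 < (s - ε) ^ 2 + ε ^ 4 := by positivity
  exact (Real.sqrt_pos.2 hpos).ne'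

theorem norm_smoothStep_le {ε : ℝ} (hε : 0 < ε) (s : ℝ) : ‖smoothStep ε s‖ ≤ 1 := by
  have hpos : 0 < √((s - ε) ^ 2 + ε ^ 4) := Real.sqrt_pos.2 (by positivity)
  have h1 : |(s - ε) / √((s - ε) ^ 2 + ε ^ 4)| ≤ 1 := by
    rw [abs_div, abs_of_pos hpos, div_le_one hpos]
    refine Real.le_sqrt_of_sq_le ?_
    rw [sq_abs]
    linarith [pow_pos hε 4]
  rw [abs_le] at h1
  rw [Real.norm_eq_abs, smoothStep, abs_le]
  constructor <;> linarith [h1.1, h1.2]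

theorem abs_smoothPosPart_sub_le {ε : ℝ} (hε : 0 < ε) (hε1 : ε ≤ 1) (s : ℝ) :
    |(s + √((s - ε) ^ 2 + ε ^ 4)) / 2 - max s 0| ≤ ε := by
  have h1 : |s - ε| ≤ √((s - ε) ^ 2 + ε ^ 4) := by
    refine Real.le_sqrt_of_sq_le ?_
    rw [sq_abs]
    linarith [pow_pos hε 4]
  have h2 : √((s - ε) ^ 2 + ε ^ 4) ≤ |s - ε| + ε ^ 2 := by
    refine Real.sqrt_le_iff.2 ⟨by positivity, ?_⟩
    nlinarith [sq_abs (s - ε), abs_nonneg (s - ε), sq_nonneg ε]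
  have h3 : ε ^ 2 ≤ ε := by nlinarith
  rcases max_cases s 0 with ⟨h, h'⟩ | ⟨h, h'⟩ <;> rw [h, abs_le] <;>
    rcases abs_cases (s - ε) with ⟨h4, h5⟩ | ⟨h4, h5⟩ <;> constructor <;> linarith

/-- The smoothed steps are shifted to the right by `ε ≫ ε²`, so that the limit at `0` is `0`. -/
theorem tendsto_smoothStep {e : ℕ → ℝ} (he : ∀ n, 0 < e n) (hlim : Tendsto e atTop (𝓝 0)) (s : ℝ) :
    Tendsto (fun n => smoothStep (e n) s) atTop (𝓝 (if 0 < s then 1 else 0)) := by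
  rcases eq_or_ne s 0 with rfl | hs
  · have h1 : ∀ n, smoothStep (e n) 0 = (1 - 1 / √(1 + e n ^ 2)) / 2 := by
      intro n
      have h2 : √((0 - e n) ^ 2 + e n ^ 4) = e n * √(1 + e n ^ 2) := by
        rw [show (0 - e n) ^ 2 + e n ^ 4 = e n ^ 2 * (1 + e n ^ 2) by ring,
          Real.sqrt_mul (sq_nonneg _), Real.sqrt_sq (he n).le]
      have h3 : 0 < √(1 + e n ^ 2) := Real.sqrt_pos.2 (by positivity)
      have h4 := he n
      rw [smoothStep, h2]
      field_simp
      ring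
    simp only [h1, lt_irrefl, if_false]
    have h2 : Continuous fun x : ℝ => (1 - 1 / √(1 + x ^ 2)) / 2 := by
      refine (continuous_const.sub (Continuous.div (by fun_prop) (by fun_prop) fun x => ?_)).div_const 2
      exact (Real.sqrt_pos.2 (by positivity)).ne'
    simpa [Function.comp_def] using (h2.tendsto 0).comp hlim
  · have h1 : ContinuousAt (fun x : ℝ => (1 + (s - x) / √((s - x) ^ 2 + x ^ 4)) / 2) 0 := by
      refine (continuousAt_const.add (ContinuousAt.div (by fun_prop) (by fun_prop) ?_)).div_const 2
      exact (Real.sqrt_pos.2 (by positivity)).ne'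
    have h2 := h1.tendsto.comp hlim
    have h3 : (1 + (s - 0) / √((s - 0) ^ 2 + 0 ^ 4)) / 2 = if 0 < s then (1 : ℝ) else 0 := by
      have : √((s - 0) ^ 2 + 0 ^ 4) = |s| := by
        rw [← Real.sqrt_sq_eq_abs]
        congr 1
        ring
      rw [this, sub_zero]
      split_ifs with h
      · rw [abs_of_pos h, div_self hs]
        norm_num
      · rw [abs_of_neg (lt_of_le_of_ne (not_lt.1 h) hs), div_neg, div_self hs]
        norm_num
    rw [← h3]
    exact h2

/-- The positive part `u⁺` has weak gradient `∇u` on `{u > 0}` and `0` elsewhere. -/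
theorem IsWeakGradient.posPart (hΩ : IsOpen Ω) {u : RN N → ℝ} {G : RN N → RN N}
    (h : IsWeakGradient Ω u G) :
    IsWeakGradient Ω (fun x => max (u x) 0) ({x | 0 < u x}.indicator G) := by
  have hum := h.1.aestronglyMeasurable
  have hset : NullMeasurableSet {x | 0 < u x} (volume.restrict Ω) :=
    nullMeasurableSet_lt aemeasurable_const hum.aemeasurable
  have hpos : LocallyIntegrableOn (fun x => max (u x) 0) Ω :=
    h.1.of_norm_le (hum.sup aestronglyMeasurable_const) (fun x _ => by
      rw [Real.norm_eq_abs, Real.norm_eq_abs, abs_of_nonneg (le_max_right _ _)]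
      exact max_le (le_abs_self _) (abs_nonneg _)) hΩ.measurableSet
  have hGpos : LocallyIntegrableOn ({x | 0 < u x}.indicator G) Ω :=
    h.2.1.of_norm_le (h.2.1.aestronglyMeasurable.indicator₀ hset)
      (fun x _ => norm_indicator_le_norm_self _ _) hΩ.measurableSet
  refine .of_approx hΩ.measurableSet hpos hGpos fun K hK hKΩ => ?_
  have hKm : volume.restrict K ≤ volume.restrict Ω := Measure.restrict_mono hKΩ le_rfl
  have : IsFiniteMeasure (volume.restrict K) := ⟨by simpa using hK.measure_lt_top⟩
  let e : ℕ → ℝ := fun n => 1 / ((n : ℝ) + 1)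
  have he : ∀ n, 0 < e n := fun n => by positivity
  have he1 : ∀ n, e n ≤ 1 := fun n => by
    rw [div_le_one (by positivity)]
    linarith [(n.cast_nonneg : (0 : ℝ) ≤ n)]
  have hlim : Tendsto e atTop (𝓝 0) := tendsto_one_div_add_atTop_nhds_zero_nat
  have huK := hum.mono_measure hKm
  have hGK := h.2.1.integrableOn_compact_subset hKΩ hK
  refine ⟨_, _, fun n => h.comp hΩ (hasDerivAt_smoothPosPart (he n)) (continuous_smoothStep (he n))
    (norm_smoothStep_le (he n)), ?_, ?_⟩
  · refine tendsto_eLpNorm_zero_of_dominated one_ne_zero ENNReal.one_ne_top (b := fun _ => 1)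
      (fun n => ?_) (memLp_const 1) (fun n => Eventually.of_forall fun x => ?_)
      (Eventually.of_forall fun x => ?_)
    · refine AEStronglyMeasurable.sub ?_ (huK.sup aestronglyMeasurable_const)
      exact Continuous.comp_aestronglyMeasurable
        (g := fun s => (s + √((s - e n) ^ 2 + e n ^ 4)) / 2) (by fun_prop) huK
    · exact (abs_smoothPosPart_sub_le (he n) (he1 n) (u x)).trans (he1 n)
    · exact squeeze_zero_norm (fun n => abs_smoothPosPart_sub_le (he n) (he1 n) (u x)) hlim
  · refine tendsto_eLpNorm_zero_of_dominated one_ne_zero ENNReal.one_ne_top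
      (b := fun x => 2 * ‖G x‖)
      (fun n => ?_) (memLp_one_iff_integrable.2 (hGK.norm.const_mul _))
      (fun n => Eventually.of_forall fun x => ?_) (Eventually.of_forall fun x => ?_)
    · exact (((continuous_smoothStep (he n)).comp_aestronglyMeasurable huK).smul
        hGK.aestronglyMeasurable).sub (hGK.aestronglyMeasurable.indicator₀ (hset.mono_ac
          (Measure.absolutelyContinuous_of_le hKm)))
    · refine (norm_sub_le _ _).trans ?_
      have h1 : ‖smoothStep (e n) (u x) • G x‖ ≤ 1 * ‖G x‖ := by
        rw [norm_smul]
        exact mul_le_mul_of_nonneg_right (norm_smoothStep_le (he n) _) (norm_nonneg _)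
      have h2 := norm_indicator_le_norm_self (s := {x | 0 < u x}) G x
      linarith
    · have h1 := ((tendsto_smoothStep he hlim (u x)).smul_const (G x)).sub_const
        ({x | 0 < u x}.indicator G x)
      refine h1.trans_eq ?_
      by_cases hx : 0 < u x <;> simp [hx]

/-- The weak gradient of `u` vanishes almost everywhere on the level set `{u = 0}`. -/
theorem IsWeakGradient.ae_eq_zero_of_eq_zero (hΩ : IsOpen Ω) {u : RN N → ℝ} {G : RN N → RN N}
    (h : IsWeakGradient Ω u G) : ∀ᵐ x ∂(volume.restrict Ω), u x = 0 → G x = 0 := by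
  -- Compare `u` with `u⁺ - u⁻`, whose weak gradient is `0` on `{u = 0}`.
  have h1 := (h.posPart hΩ).sub (h.neg.posPart hΩ)
  have h2 : (fun x => max (u x) 0 - max (- u x) 0) = u := by
    ext x
    exact max_zero_sub_max_neg_zero_eq_self (u x)
  rw [h2] at h1
  filter_upwards [h.ae_eq hΩ h1 (EventuallyEq.refl _ _)] with x hx hux
  rw [hx]
  simp [hux]

/-- Chain rule for a `C^1` function of a bounded function. -/
theorem IsWeakGradient.comp_of_bounded (hΩ : IsOpen Ω) {u : RN N → ℝ} {G : RN N → RN N}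
    (h : IsWeakGradient Ω u G) {M : ℝ} (hM : ∀ x ∈ Ω, |u x| ≤ M) {η η' : ℝ → ℝ}
    (hη : ∀ s, HasDerivAt η (η' s) s) (hη' : Continuous η') :
    IsWeakGradient Ω (fun x => η (u x)) (fun x => η' (u x) • G x) := by
  rcases Ω.eq_empty_or_nonempty with rfl | ⟨x₀, hx₀⟩
  · exact isWeakGradient_zero.congr_ae (by simp [EventuallyEq]) (by simp [EventuallyEq])
  have hM0 : 0 ≤ M := (abs_nonneg _).trans (hM x₀ hx₀)
  -- Extend `η'` from `[-M, M]` by constants and integrate.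
  let θ' : ℝ → ℝ := fun s => η' (max (-M) (min s M))
  have hθ' : Continuous θ' := by fun_prop
  let θ : ℝ → ℝ := fun s => η 0 + ∫ t in (0 : ℝ)..s, θ' t
  have hθ : ∀ s, HasDerivAt θ (θ' s) s := fun s =>
    ((hθ'.integral_hasStrictDerivAt 0 s).hasDerivAt).const_add _
  have hclamp : ∀ s, |s| ≤ M → max (-M) (min s M) = s := fun s hs => by
    rw [abs_le] at hs
    rw [min_eq_left hs.2, max_eq_right hs.1]
  have hθη : ∀ s, |s| ≤ M → θ s = η s := by
    intro s hs
    have h1 : ∫ t in (0 : ℝ)..s, θ' t = ∫ t in (0 : ℝ)..s, η' t := by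
      refine intervalIntegral.integral_congr fun t ht => ?_
      have : |t| ≤ M := by
        rw [abs_le] at hs ⊢
        rcases Set.mem_uIcc.1 ht with h | h <;> constructor <;> linarith [h.1, h.2, hs.1, hs.2]
      simp only [θ', hclamp t this]
    simp only [θ]
    rw [h1, intervalIntegral.integral_eq_sub_of_hasDerivAt (fun t _ => hη t)
      (hη'.intervalIntegrable _ _)]
    ring
  obtain ⟨C, hC⟩ := (isCompact_Icc (a := -M) (b := M)).exists_bound_of_continuousOn
    hη'.continuousOn
  have hC' : ∀ s, ‖θ' s‖ ≤ C := fun s =>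
    hC _ ⟨le_max_left _ _, max_le (by linarith) (min_le_right _ _)⟩
  refine (h.comp hΩ hθ hθ' hC').congr_ae ?_ ?_
  · filter_upwards [ae_restrict_mem hΩ.measurableSet] with x hx
    exact hθη _ (hM x hx)
  · filter_upwards [ae_restrict_mem hΩ.measurableSet] with x hx
    simp only [θ', hclamp _ (hM x hx)]

end Truncation

/-! ### The space of Sobolev functions vanishing on the boundary -/

section Sobolev

open scoped ENNReal Convolution
open ContinuousLinearMap (lsmul)

variable {N : ℕ} {Ω : Set (RN N)} {p : ℝ}

theorem IsWeakGradient.weakGradient_ae_eq (hΩ : IsOpen Ω) {u : RN N → ℝ} {G : RN N → RN N}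
    (h : IsWeakGradient Ω u G) : weakGradient Ω u =ᵐ[volume.restrict Ω] G :=
  (isWeakGradient_weakGradient ⟨G, h⟩).ae_eq hΩ h (EventuallyEq.refl _ _)

theorem MemSobolev.isWeakGradient {u : RN N → ℝ} (h : MemSobolev Ω p u) :
    IsWeakGradient Ω u (weakGradient Ω u) :=
  isWeakGradient_weakGradient h.2.1

theorem IsWeakGradient.memSobolev (hΩ : IsOpen Ω) {u : RN N → ℝ} {G : RN N → RN N}
    (h : IsWeakGradient Ω u G) (hu : MemLpOn Ω p u) (hG : MemLpOn Ω p G) : MemSobolev Ω p u :=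
  ⟨hu, ⟨G, h⟩, MemLp.ae_eq (h.weakGradient_ae_eq hΩ).symm hG⟩

theorem IsTestFunction.memLpOn {φ : RN N → ℝ} (hφ : IsTestFunction Ω φ) : MemLpOn Ω p φ :=
  (hφ.1.continuous.memLp_of_hasCompactSupport hφ.2.1).restrict Ω

theorem IsTestFunction.gradient_memLpOn {φ : RN N → ℝ} (hφ : IsTestFunction Ω φ) :
    MemLpOn Ω p (gradient φ) :=
  ((continuous_gradient hφ.contDiff_one).memLp_of_hasCompactSupport (hφ.2.1.mono' fun x hx => by
    by_contra h
    exact hx (gradient_eq_zero_of_notMem_tsupport h))).restrict Ω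

/-- Membership in `W₀^{1,p}` in terms of any weak gradient, with approximation up to `ε` in place
of sequences. -/
theorem IsWeakGradient.memSobolevZero_iff (hΩ : IsOpen Ω) {u : RN N → ℝ} {G : RN N → RN N}
    (h : IsWeakGradient Ω u G) :
    MemSobolevZero Ω p u ↔ MemLpOn Ω p u ∧ MemLpOn Ω p G ∧ ∀ ε : ℝ≥0∞, ε ≠ 0 →
      ∃ φ, IsTestFunction Ω φ ∧
        eLpNorm (fun x => u x - φ x) (ENNReal.ofReal p) (volume.restrict Ω) ≤ ε ∧
        eLpNorm (fun x => G x - gradient φ x) (ENNReal.ofReal p) (volume.restrict Ω) ≤ ε := by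
  have hw := h.weakGradient_ae_eq hΩ
  have e : ∀ φ : RN N → ℝ, eLpNorm (fun x => weakGradient Ω u x - gradient φ x)
      (ENNReal.ofReal p) (volume.restrict Ω)
      = eLpNorm (fun x => G x - gradient φ x) (ENNReal.ofReal p) (volume.restrict Ω) := fun φ =>
    eLpNorm_congr_ae (hw.sub (EventuallyEq.refl _ _))
  constructor
  · rintro ⟨h1, φ, hφ, h2, h3⟩
    refine ⟨h1.1, MemLp.ae_eq hw h1.2.2, fun ε hε => ?_⟩
    obtain ⟨n, hn1, hn2⟩ := ((ENNReal.tendsto_nhds_zero.1 h2 ε (pos_iff_ne_zero.2 hε)).and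
      (ENNReal.tendsto_nhds_zero.1 h3 ε (pos_iff_ne_zero.2 hε))).exists
    exact ⟨φ n, hφ n, hn1, (e _) ▸ hn2⟩
  · rintro ⟨h1, h2, h3⟩
    have hpos : ∀ n : ℕ, ((n : ℝ≥0∞)⁻¹) ≠ 0 := fun n =>
      ENNReal.inv_ne_zero.2 (ENNReal.natCast_ne_top n)
    choose φ hφ hφ1 hφ2 using fun n : ℕ => h3 _ (hpos n)
    refine ⟨h.memSobolev hΩ h1 h2, φ, hφ, ?_, ?_⟩
    · exact tendsto_of_tendsto_of_tendsto_of_le_of_le tendsto_const_nhds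
        ENNReal.tendsto_inv_nat_nhds_zero (fun _ => zero_le) hφ1
    · simp only [e]
      exact tendsto_of_tendsto_of_tendsto_of_le_of_le tendsto_const_nhds
        ENNReal.tendsto_inv_nat_nhds_zero (fun _ => zero_le) hφ2

/-- `W₀^{1,p}` is closed in `W^{1,p}`. -/
theorem IsWeakGradient.memSobolevZero_of_approx (hΩ : IsOpen Ω) (hp : 1 ≤ p) {u : RN N → ℝ}
    {G : RN N → RN N} (h : IsWeakGradient Ω u G) (hu : MemLpOn Ω p u) (hG : MemLpOn Ω p G)
    (H : ∀ ε : ℝ≥0∞, ε ≠ 0 → ∃ v V, IsWeakGradient Ω v V ∧ MemSobolevZero Ω p v ∧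
      eLpNorm (fun x => u x - v x) (ENNReal.ofReal p) (volume.restrict Ω) ≤ ε ∧
      eLpNorm (fun x => G x - V x) (ENNReal.ofReal p) (volume.restrict Ω) ≤ ε) :
    MemSobolevZero Ω p u := by
  refine (h.memSobolevZero_iff hΩ).2 ⟨hu, hG, fun ε hε => ?_⟩
  have hε2 : ε / 2 ≠ 0 := (ENNReal.half_pos hε).ne'
  have hp1 : (1 : ℝ≥0∞) ≤ ENNReal.ofReal p := ENNReal.one_le_ofReal.2 hp
  obtain ⟨v, V, hvV, hv, h1, h2⟩ := H _ hε2
  obtain ⟨hvp, hVp, hv'⟩ := (hvV.memSobolevZero_iff hΩ).1 hv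
  obtain ⟨φ, hφ, h3, h4⟩ := hv' _ hε2
  refine ⟨φ, hφ, ?_, ?_⟩
  · have := eLpNorm_add_le (hu.1.sub hvp.1) (hvp.1.sub (hφ.memLpOn (p := p)).1) hp1
    rw [sub_add_sub_cancel] at this
    exact this.trans ((add_le_add h1 h3).trans_eq (ENNReal.add_halves ε))
  · have := eLpNorm_add_le (hG.1.sub hVp.1) (hVp.1.sub (hφ.gradient_memLpOn (p := p)).1) hp1
    rw [sub_add_sub_cancel] at this
    exact this.trans ((add_le_add h2 h4).trans_eq (ENNReal.add_halves ε))

theorem IsTestFunction.add {φ ψ : RN N → ℝ} (hφ : IsTestFunction Ω φ) (hψ : IsTestFunction Ω ψ) :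
    IsTestFunction Ω (fun x => φ x + ψ x) :=
  ⟨hφ.1.add hψ.1, hφ.2.1.add hψ.2.1,
    (tsupport_add φ ψ).trans (Set.union_subset hφ.2.2 hψ.2.2)⟩

theorem IsTestFunction.const_mul {φ : RN N → ℝ} (hφ : IsTestFunction Ω φ) (c : ℝ) :
    IsTestFunction Ω (fun x => c * φ x) :=
  ⟨contDiff_const.mul hφ.1, hφ.2.1.mul_left,
    (closure_mono (Function.support_mul_subset_right _ _)).trans hφ.2.2⟩

theorem MemSobolevZero.add (hΩ : IsOpen Ω) (hp : 1 ≤ p) {u v : RN N → ℝ}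
    (hu : MemSobolevZero Ω p u) (hv : MemSobolevZero Ω p v) :
    MemSobolevZero Ω p (fun x => u x + v x) := by
  have hp1 : (1 : ℝ≥0∞) ≤ ENNReal.ofReal p := ENNReal.one_le_ofReal.2 hp
  have hu0 := hu.1.isWeakGradient
  have hv0 := hv.1.isWeakGradient
  obtain ⟨hu1, hu2, hu3⟩ := (hu0.memSobolevZero_iff hΩ).1 hu
  obtain ⟨hv1, hv2, hv3⟩ := (hv0.memSobolevZero_iff hΩ).1 hv
  refine ((hu0.add hv0).memSobolevZero_iff hΩ).2 ⟨hu1.add hv1, hu2.add hv2, fun ε hε => ?_⟩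
  have hε2 : ε / 2 ≠ 0 := (ENNReal.half_pos hε).ne'
  obtain ⟨φ, hφ, h1, h2⟩ := hu3 _ hε2
  obtain ⟨ψ, hψ, h3, h4⟩ := hv3 _ hε2
  refine ⟨_, hφ.add hψ, ?_, ?_⟩
  · have := eLpNorm_add_le (hu1.1.sub (hφ.memLpOn (p := p)).1)
      (hv1.1.sub (hψ.memLpOn (p := p)).1) hp1
    rw [sub_add_sub_comm] at this
    exact this.trans ((add_le_add h1 h3).trans_eq (ENNReal.add_halves ε))
  · have := eLpNorm_add_le (hu2.1.sub (hφ.gradient_memLpOn (p := p)).1)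
      (hv2.1.sub (hψ.gradient_memLpOn (p := p)).1) hp1
    rw [sub_add_sub_comm] at this
    have e : gradient (fun x => φ x + ψ x) = gradient φ + gradient ψ := by
      ext1 x
      have := fderiv_add (hφ.contDiff_one.differentiable one_ne_zero x)
        (hψ.contDiff_one.differentiable one_ne_zero x)
      simp only [gradient, Pi.add_apply, ← map_add]
      congr 1
    rw [e]
    exact this.trans ((add_le_add h2 h4).trans_eq (ENNReal.add_halves ε))

theorem MemSobolevZero.const_mul (hΩ : IsOpen Ω) {u : RN N → ℝ} (hu : MemSobolevZero Ω p u)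
    (c : ℝ) : MemSobolevZero Ω p (fun x => c * u x) := by
  have hu0 := hu.1.isWeakGradient
  have hw := (hu0.const_mul c).weakGradient_ae_eq hΩ
  obtain ⟨h1, φ, hφ, h2, h3⟩ := hu
  have key : ∀ {F : Type} [NormedAddCommGroup F] [NormedSpace ℝ F] (f : ℕ → RN N → F),
      Tendsto (fun n => eLpNorm (f n) (ENNReal.ofReal p) (volume.restrict Ω)) atTop (𝓝 0) →
      Tendsto (fun n => eLpNorm (c • f n) (ENNReal.ofReal p) (volume.restrict Ω)) atTop (𝓝 0) := by
    intro F _ _ f hf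
    simp only [eLpNorm_const_smul]
    simpa using ENNReal.Tendsto.const_mul hf (Or.inr enorm_ne_top)
  refine ⟨(hu0.const_mul c).memSobolev hΩ (h1.1.const_mul c) (h1.2.2.const_smul c),
    fun n x => c * φ n x, fun n => (hφ n).const_mul c, ?_, ?_⟩
  · refine (key _ h2).congr fun n => ?_
    congr 1
    ext1 x
    simp [mul_sub]
  · refine (key _ h3).congr fun n => eLpNorm_congr_ae ?_
    filter_upwards [hw] with x hx
    have e : gradient (fun x => c * φ n x) x = c • gradient (φ n) x :=
      gradient_comp (h := fun s => c * s) (h' := fun _ => c)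
        (fun s => by simpa using (hasDerivAt_id s).const_mul c)
        ((hφ n).contDiff_one.differentiable one_ne_zero) x
    rw [hx, e]
    simp [smul_sub]

/-- A function in `W^{1,p}` that vanishes off a compact subset of `Ω` is in `W₀^{1,p}`. -/
theorem IsWeakGradient.memSobolevZero_of_compact (hΩ : IsOpen Ω) (hp : 1 ≤ p) {u : RN N → ℝ}
    {G : RN N → RN N} (h : IsWeakGradient Ω u G) (hu : MemLpOn Ω p u) (hG : MemLpOn Ω p G)
    {K : Set (RN N)} (hK : IsCompact K) (hKΩ : K ⊆ Ω) (h0 : ∀ x ∈ Ω, x ∉ K → u x = 0) :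
    MemSobolevZero Ω p u := by
  have hp1 : (1 : ℝ≥0∞) ≤ ENNReal.ofReal p := ENNReal.one_le_ofReal.2 hp
  -- The weak gradient vanishes off `K`, by uniqueness on the open set `Ω \ K`.
  have hG0 : ∀ᵐ x ∂(volume.restrict Ω), x ∉ K → G x = 0 := by
    have hO : IsOpen (Ω \ K) := hΩ.sdiff hK.isClosed
    have h1 := (h.mono hΩ.measurableSet Set.sdiff_subset).ae_eq hO
      (isWeakGradient_zero (Ω := Ω \ K)) (by
        filter_upwards [ae_restrict_mem hO.measurableSet] with x hx
        exact h0 x hx.1 hx.2)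
    rw [EventuallyEq, ae_restrict_iff' hO.measurableSet] at h1
    rw [ae_restrict_iff' hΩ.measurableSet]
    filter_upwards [h1] with x hx hxΩ hxK
    exact hx ⟨hxΩ, hxK⟩
  obtain ⟨δ, hδ, hδΩ⟩ := hK.exists_cthickening_subset_open hΩ hKΩ
  set L := Metric.cthickening δ K with hL
  have hLc : IsCompact L := hK.cthickening
  have hKL : K ⊆ L := Metric.self_subset_cthickening K
  have huL : MemLp (L.indicator u) (ENNReal.ofReal p) volume :=
    (memLp_indicator_iff_restrict hLc.measurableSet).2
      (hu.mono_measure (Measure.restrict_mono hδΩ le_rfl))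
  have hGL : MemLp (L.indicator G) (ENNReal.ofReal p) volume :=
    (memLp_indicator_iff_restrict hLc.measurableSet).2
      (hG.mono_measure (Measure.restrict_mono hδΩ le_rfl))
  let ψ : ℕ → RN N → ℝ := fun n =>
    (shrinkingBump N n).normed volume ⋆[lsmul ℝ ℝ, volume] L.indicator u
  have hev : ∀ᶠ n in atTop, (shrinkingBump N n).rOut ≤ δ / 2 :=
    (tendsto_shrinkingBump_rOut.eventually (gt_mem_nhds (half_pos hδ))).mono fun n hn => le_of_lt hn
  -- The mollifications are supported in the `δ / 2`-thickening of `K`; every point there is the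
  -- centre of a ball of radius `δ / 2` inside `L`.
  have hsupp : ∀ n, (shrinkingBump N n).rOut ≤ δ / 2 →
      tsupport (ψ n) ⊆ Metric.cthickening (δ / 2) K := by
    intro n hn
    refine closure_minimal (fun x hx => ?_) Metric.isClosed_cthickening
    obtain ⟨y, hy, z, hz, rfl⟩ := support_convolution_subset _ hx
    rw [ContDiffBump.support_normed_eq, mem_ball_zero_iff] at hy
    have hzK : z ∈ K := by
      by_contra hzK
      refine hz ?_
      by_cases hzL : z ∈ L
      · rw [Set.indicator_of_mem hzL, h0 z (hδΩ hzL) hzK]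
      · exact Set.indicator_of_notMem hzL _
    refine Metric.mem_cthickening_of_dist_le _ z _ _ hzK ?_
    rw [dist_eq_norm, add_sub_cancel_right]
    exact hy.le.trans hn
  have htest : ∀ n, (shrinkingBump N n).rOut ≤ δ / 2 → IsTestFunction Ω (ψ n) := by
    intro n hn
    refine ⟨(shrinkingBump N n).hasCompactSupport_normed.contDiff_convolution_left _
      ((shrinkingBump N n).contDiff_normed (n := ⊤)) (huL.locallyIntegrable hp1), ?_, ?_⟩
    · exact HasCompactSupport.of_support_subset_isCompact hK.cthickening
        ((subset_tsupport _).trans (hsupp n hn))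
    · exact (hsupp n hn).trans ((Metric.cthickening_mono (by linarith) K).trans hδΩ)
  have hptop : ENNReal.ofReal p ≠ ⊤ := ENNReal.ofReal_ne_top
  have lim1 := ContDiffBump.tendsto_eLpNorm_convolution_sub
    (tendsto_shrinkingBump_rOut (N := N)) hp1 hptop huL
  have lim2 := ContDiffBump.tendsto_eLpNorm_convolution_sub
    (tendsto_shrinkingBump_rOut (N := N)) hp1 hptop hGL
  refine (h.memSobolevZero_iff hΩ).2 ⟨hu, hG, fun ε hε => ?_⟩
  obtain ⟨n, hn, hn1, hn2⟩ := (hev.and ((ENNReal.tendsto_nhds_zero.1 lim1 ε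
    (pos_iff_ne_zero.2 hε)).and (ENNReal.tendsto_nhds_zero.1 lim2 ε
    (pos_iff_ne_zero.2 hε)))).exists
  refine ⟨ψ n, htest n hn, le_trans ?_ hn1, le_trans ?_ hn2⟩
  · refine (eLpNorm_mono_ae ?_).trans (eLpNorm_restrict_le _ _ _ Ω)
    filter_upwards [ae_restrict_mem hΩ.measurableSet] with x hx
    rw [norm_sub_rev, Pi.sub_apply]
    by_cases hxL : x ∈ L
    · rw [Set.indicator_of_mem hxL]
    · rw [Set.indicator_of_notMem hxL, h0 x hx fun h => hxL (hKL h)]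
  · refine (eLpNorm_mono_ae ?_).trans (eLpNorm_restrict_le _ _ _ Ω)
    filter_upwards [hG0] with x hx
    by_cases hxL : x ∈ Metric.cthickening (δ / 2) K
    · have hb : Metric.closedBall x (shrinkingBump N n).rOut ⊆ L := by
        refine (Metric.closedBall_subset_closedBall hn).trans
          ((Metric.closedBall_subset_cthickening hxL (δ / 2)).trans ?_)
        refine (Metric.cthickening_cthickening_subset (half_pos hδ).le (half_pos hδ).le K).trans ?_
        rw [add_halves]
      have hx' : x ∈ L := Metric.cthickening_mono (by linarith) K hxL
      rw [norm_sub_rev, Pi.sub_apply, Set.indicator_of_mem hx',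
        h.gradient_convolution hLc hδΩ _ hb]
    · rw [gradient_eq_zero_of_notMem_tsupport fun h' => hxL (hsupp n hn h'),
        hx fun h' => hxL (Metric.self_subset_cthickening K h')]
      simp

/-- A function in `W^{1,p}` that lies between `0` and a function `w` in `W₀^{1,p}` is itself in
`W₀^{1,p}`: it is the limit of its minima with test functions approximating `w`. -/
theorem MemSobolevZero.of_nonneg_of_le (hΩ : IsOpen Ω) (hp : 1 ≤ p) {v w : RN N → ℝ}
    (hw : MemSobolevZero Ω p w) (hv : MemSobolev Ω p v) (hv0 : ∀ x ∈ Ω, 0 ≤ v x)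
    (hvw : ∀ x ∈ Ω, v x ≤ w x) : MemSobolevZero Ω p v := by
  have hp1 : (1 : ℝ≥0∞) ≤ ENNReal.ofReal p := ENNReal.one_le_ofReal.2 hp
  have hp0 : ENNReal.ofReal p ≠ 0 := (one_pos.trans_le hp1).ne'
  have hptop : ENNReal.ofReal p ≠ ⊤ := ENNReal.ofReal_ne_top
  obtain ⟨hw1, φ, hφ, lim1, lim2⟩ := hw
  set V := weakGradient Ω v with hV
  set W := weakGradient Ω w with hW
  have hvV : IsWeakGradient Ω v V := hv.isWeakGradient
  have hwW : IsWeakGradient Ω w W := hw1.isWeakGradient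
  have hVp : MemLpOn Ω p V := hv.2.2
  have hWp : MemLpOn Ω p W := hw1.2.2
  have hφG : ∀ n, IsWeakGradient Ω (φ n) (gradient (φ n)) := fun n =>
    isWeakGradient_gradient hΩ.measurableSet (hφ n).contDiff_one
  obtain ⟨ns, hns, hae⟩ := (tendstoInMeasure_of_tendsto_eLpNorm (f := φ) (g := w) hp0
    (fun n => (hφ n).1.continuous.aestronglyMeasurable) hw1.1.1
    (lim1.congr fun n => eLpNorm_sub_comm w (φ n) _ _)).exists_seq_tendsto_ae
  let S : ℕ → Set (RN N) := fun n => {x | 0 < v x - φ (ns n) x}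
  have hS : ∀ n, NullMeasurableSet (S n) (volume.restrict Ω) := fun n =>
    nullMeasurableSet_lt aemeasurable_const
      (hv.1.1.sub (hφ (ns n)).1.continuous.aestronglyMeasurable).aemeasurable
  -- `u n` is the minimum of `v` and `φ (ns n)`; it vanishes off the support of `φ (ns n)`, as
  -- `v ≥ 0`.
  let u : ℕ → RN N → ℝ := fun n x => v x - max (v x - φ (ns n) x) 0
  let U : ℕ → RN N → RN N := fun n x =>
    V x - (S n).indicator (fun x => V x - gradient (φ (ns n)) x) x
  have huU : ∀ n, IsWeakGradient Ω (u n) (U n) := fun n =>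
    hvV.sub ((hvV.sub (hφG (ns n))).posPart hΩ)
  have hup : ∀ n, MemLpOn Ω p (u n) := fun n =>
    hv.1.sub ((hv.1.sub (hφ (ns n)).memLpOn).pos_part)
  have hUp : ∀ n, MemLpOn Ω p (U n) := fun n => by
    refine hVp.sub ((hVp.sub ((hφ (ns n)).gradient_memLpOn)).mono ?_
      (Eventually.of_forall fun x => norm_indicator_le_norm_self _ _))
    exact (hVp.1.sub ((hφ (ns n)).gradient_memLpOn (p := p)).1).indicator₀ (hS n)
  have hu0 : ∀ n, MemSobolevZero Ω p (u n) := fun n =>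
    (huU n).memSobolevZero_of_compact hΩ hp (hup n) (hUp n) (hφ (ns n)).2.1 (hφ (ns n)).2.2
      fun x hx hxK => by
        simp only [u, image_eq_zero_of_notMem_tsupport hxK, sub_zero, max_eq_left (hv0 x hx),
          sub_self]
  have lim3 : Tendsto (fun n => eLpNorm (fun x => v x - u n x) (ENNReal.ofReal p)
      (volume.restrict Ω)) atTop (𝓝 0) := by
    refine tendsto_of_tendsto_of_tendsto_of_le_of_le tendsto_const_nhds
      (lim1.comp hns.tendsto_atTop) (fun _ => zero_le) fun n => eLpNorm_mono_ae ?_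
    filter_upwards [ae_restrict_mem hΩ.measurableSet] with x hx
    simp only [u, sub_sub_cancel, Real.norm_eq_abs]
    rw [abs_of_nonneg (le_max_right _ _)]
    exact max_le ((sub_le_sub_right (hvw x hx) _).trans (le_abs_self _)) (abs_nonneg _)
  -- `{v > φ (ns n)}` eventually leaves every point of `{v < w}`, and `V = W` a.e. on `{v = w}`.
  have lim4 : Tendsto (fun n => eLpNorm ((S n).indicator fun x => V x - W x) (ENNReal.ofReal p)
      (volume.restrict Ω)) atTop (𝓝 0) := by
    refine tendsto_eLpNorm_zero_of_dominated hp0 hptop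
      (fun n => (hVp.1.sub hWp.1).indicator₀ (hS n)) (hVp.sub hWp).norm
      (fun n => Eventually.of_forall fun x => norm_indicator_le_norm_self _ _) ?_
    filter_upwards [hae, ae_restrict_mem hΩ.measurableSet,
      (hvV.sub hwW).ae_eq_zero_of_eq_zero hΩ] with x hx hxΩ hx0
    rcases (hvw x hxΩ).eq_or_lt with heq | hlt
    · have : V x - W x = 0 := hx0 (sub_eq_zero.2 heq)
      simp [Set.indicator_apply, this]
    · refine tendsto_const_nhds.congr' ?_
      filter_upwards [hx.eventually (lt_mem_nhds hlt)] with n hn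
      rw [Set.indicator_of_notMem]
      simp only [S, Set.mem_ofPred_eq, not_lt]
      linarith
  have lim5 : Tendsto (fun n => eLpNorm (fun x => V x - U n x) (ENNReal.ofReal p)
      (volume.restrict Ω)) atTop (𝓝 0) := by
    have h1 := lim4.add (lim2.comp hns.tendsto_atTop)
    rw [add_zero] at h1
    refine tendsto_of_tendsto_of_tendsto_of_le_of_le tendsto_const_nhds h1
      (fun _ => zero_le) fun n => ?_
    have hm := hWp.1.sub ((hφ (ns n)).gradient_memLpOn (p := p)).1
    have e : (fun x => V x - U n x) = ((S n).indicator fun x => V x - W x) +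
        (S n).indicator fun x => W x - gradient (φ (ns n)) x := by
      ext1 x
      by_cases hx : x ∈ S n <;> simp [U, hx]
    rw [e]
    refine (eLpNorm_add_le ((hVp.1.sub hWp.1).indicator₀ (hS n)) (hm.indicator₀ (hS n)) hp1).trans
      (add_le_add le_rfl ?_)
    exact eLpNorm_indicator_le _
  refine hvV.memSobolevZero_of_approx hΩ hp hv.1 hVp fun ε hε => ?_
  obtain ⟨n, h1, h2⟩ := ((ENNReal.tendsto_nhds_zero.1 lim3 ε (pos_iff_ne_zero.2 hε)).and
    (ENNReal.tendsto_nhds_zero.1 lim5 ε (pos_iff_ne_zero.2 hε))).exists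
  exact ⟨u n, U n, huU n, hu0 n, h1, h2⟩

/-- A nonnegative function in `W₀^{1,p}` of a bounded set whose weak gradient vanishes is zero:
for test functions `φ`, `∫ φ = - ∫ xᵢ ∂ᵢφ`. -/
theorem MemSobolevZero.ae_eq_zero_of_gradient_eq_zero (hΩ : IsOpen Ω)
    (hb : Bornology.IsBounded Ω) (hp : 1 ≤ p) (i : Fin N) {v : RN N → ℝ}
    (hv : MemSobolevZero Ω p v) (hv0 : ∀ x ∈ Ω, 0 ≤ v x)
    (hG : ∀ᵐ x ∂(volume.restrict Ω), weakGradient Ω v x = 0) :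
    ∀ᵐ x ∂(volume.restrict Ω), v x = 0 := by
  have hp1 : (1 : ℝ≥0∞) ≤ ENNReal.ofReal p := ENNReal.one_le_ofReal.2 hp
  have : IsFiniteMeasure (volume.restrict Ω) := ⟨by simpa using hb.measure_lt_top⟩
  obtain ⟨hv1, φ, hφ, lim1, lim2⟩ := hv
  have toL1 : ∀ {F : Type} [NormedAddCommGroup F] (f : ℕ → RN N → F),
      (∀ n, AEStronglyMeasurable (f n) (volume.restrict Ω)) →
      Tendsto (fun n => eLpNorm (f n) (ENNReal.ofReal p) (volume.restrict Ω)) atTop (𝓝 0) →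
      Tendsto (fun n => eLpNorm (f n) 1 (volume.restrict Ω)) atTop (𝓝 0) := by
    intro F _ f hf hlim
    have h1 := ENNReal.Tendsto.mul_const (b := volume.restrict Ω Set.univ ^
      (1 / (1 : ℝ≥0∞).toReal - 1 / (ENNReal.ofReal p).toReal)) hlim (Or.inr ?_)
    · rw [zero_mul] at h1
      exact tendsto_of_tendsto_of_tendsto_of_le_of_le tendsto_const_nhds h1 (fun _ => zero_le)
        fun n => eLpNorm_le_eLpNorm_mul_rpow_measure_univ hp1 (hf n)
    · refine ENNReal.rpow_ne_top_of_nonneg ?_ (measure_ne_top _ _)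
      rw [ENNReal.toReal_ofReal (by linarith), ENNReal.toReal_one, div_one, sub_nonneg]
      exact (div_le_one (by linarith)).2 hp
  have hvi : Integrable v (volume.restrict Ω) := hv1.1.integrable hp1
  have l1 : Tendsto (fun n => ∫ x in Ω, φ n x * 1) atTop (𝓝 (∫ x in Ω, v x * 1)) := by
    refine tendsto_integral_mul_of_tendsto_eLpNorm_one (C := 1)
      (fun n => (hφ n).memLpOn.integrable hp1) hvi
      aestronglyMeasurable_const (by simp) ?_
    refine (toL1 _ (fun n => hv1.1.1.sub ((hφ n).memLpOn (p := p)).1) lim1).congr fun n => ?_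
    exact eLpNorm_sub_comm v (φ n) _ _
  obtain ⟨R, hR⟩ := hb.exists_norm_le
  let P : RN N →L[ℝ] ℝ := EuclideanSpace.proj (𝕜 := ℝ) i
  have hgi : ∀ n, Integrable (fun x => gradient (φ n) x i) (volume.restrict Ω) := fun n =>
    P.integrable_comp ((hφ n).gradient_memLpOn.integrable hp1)
  have l2 : Tendsto (fun n => ∫ x in Ω, gradient (φ n) x i * x i) atTop
      (𝓝 (∫ x in Ω, 0 * x i)) := by
    refine tendsto_integral_mul_of_tendsto_eLpNorm_one (C := R) hgi
      (integrable_zero _ _ _) P.continuous.aestronglyMeasurable ?_ ?_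
    · filter_upwards [ae_restrict_mem hΩ.measurableSet] with x hx
      exact (PiLp.norm_apply_le x i).trans (hR x hx)
    · refine tendsto_of_tendsto_of_tendsto_of_le_of_le tendsto_const_nhds
        (toL1 _ (fun n => hv1.2.2.1.sub ((hφ n).gradient_memLpOn (p := p)).1) lim2)
        (fun _ => zero_le) fun n => eLpNorm_mono_ae ?_
      filter_upwards [hG] with x hx
      simp only [Pi.sub_apply, hx, zero_sub, norm_neg, sub_zero]
      exact PiLp.norm_apply_le _ i
  have hparts : ∀ n, ∫ x in Ω, gradient (φ n) x i * x i = - ∫ x in Ω, φ n x * 1 := by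
    intro n
    have h1 := (isWeakGradient_gradient hΩ.measurableSet P.contDiff).2.2 _ (hφ n) i
    have h2 : ∀ x, gradient P x i = 1 := fun x => by
      rw [gradient_apply_eq_fderiv, P.fderiv]
      simp [P]
    simp only [h2, one_mul] at h1
    simp only [mul_one]
    rw [← h1]
    exact integral_congr_ae (Eventually.of_forall fun x => mul_comm _ _)
  have hint : ∫ x in Ω, v x = 0 := by
    have h1 := tendsto_nhds_unique (l2.congr hparts) l1.neg
    simpa using h1.symm
  have h2 := (integral_eq_zero_iff_of_nonneg_ae ((ae_restrict_iff' hΩ.measurableSet).2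
    (Eventually.of_forall hv0)) hvi).1 hint
  exact h2

end Sobolev

/-! ### Young's inequality for vectors -/

section Young

variable {E : Type*} [NormedAddCommGroup E] [InnerProductSpace ℝ E] {p : ℝ}

theorem norm_rpow_sub_two_mul_norm {F : Type*} [SeminormedAddCommGroup F] (hp : 1 < p) (ξ : F) :
    ‖ξ‖ ^ (p - 2) * ‖ξ‖ = ‖ξ‖ ^ (p - 1) := by
  -- At `ξ = 0` the factor `0 ^ (p - 2)` is a convention, but it is multiplied by `0`.
  rcases (norm_nonneg ξ).eq_or_lt with h | h
  · rw [← h, mul_zero, Real.zero_rpow (by linarith)]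
  · nth_rewrite 2 [← Real.rpow_one ‖ξ‖]
    rw [← Real.rpow_add h]
    congr 1
    ring

theorem norm_rpow_sub_two_mul_inner_self (hp : 1 < p) (ξ : E) :
    ‖ξ‖ ^ (p - 2) * ⟪ξ, ξ⟫ = ‖ξ‖ ^ p := by
  rw [real_inner_self_eq_norm_mul_norm, ← mul_assoc, norm_rpow_sub_two_mul_norm hp]
  rcases (norm_nonneg ξ).eq_or_lt with h | h
  · rw [← h, mul_zero, Real.zero_rpow (by linarith)]
  · nth_rewrite 2 [← Real.rpow_one ‖ξ‖]
    rw [← Real.rpow_add h, sub_add_cancel]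

/-- Young's inequality is strict unless the two numbers agree (Bernoulli's inequality for
their quotient). -/
theorem rpow_sub_one_mul_lt (hp : 1 < p) {s t : ℝ} (hs : 0 ≤ s) (ht : 0 ≤ t) (hst : s ≠ t) :
    t ^ (p - 1) * s < 1 / p * s ^ p + (p - 1) / p * t ^ p := by
  have hp0 : 0 < p := by linarith
  rcases ht.eq_or_lt with rfl | ht
  · rw [Real.zero_rpow (by linarith), Real.zero_rpow hp0.ne', zero_mul, mul_zero, add_zero]
    have := hs.lt_of_ne hst.symm
    positivity
  · have h1 := one_add_mul_self_lt_rpow_one_add (s := s / t - 1) (p := p)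
      (by linarith [div_nonneg hs ht.le]) (by rwa [sub_ne_zero, ne_eq, div_eq_one_iff_eq ht.ne']) hp
    rw [add_sub_cancel, Real.div_rpow hs ht.le, lt_div_iff₀ (Real.rpow_pos_of_pos ht p)] at h1
    have h2 : t ^ p = t ^ (p - 1) * t := by
      rw [← Real.rpow_add_one ht.ne', sub_add_cancel]
    have h3 : (1 + p * (s / t - 1)) * t ^ p = p * (t ^ (p - 1) * s) - (p - 1) * t ^ p := by
      rw [h2]
      field_simp
      ring
    rw [h3] at h1
    have h4 : 1 / p * s ^ p + (p - 1) / p * t ^ p = (s ^ p + (p - 1) * t ^ p) / p := by ring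
    rw [h4, lt_div_iff₀ hp0]
    linarith

theorem norm_rpow_mul_inner_le (hp : 1 < p) (ξ η : E) :
    ‖η‖ ^ (p - 2) * ⟪η, ξ⟫ ≤ ‖η‖ ^ (p - 1) * ‖ξ‖ := by
  rw [← norm_rpow_sub_two_mul_norm hp, mul_assoc]
  exact mul_le_mul_of_nonneg_left (real_inner_le_norm _ _) (by positivity)

theorem norm_rpow_mul_inner_lt (hp : 1 < p) {ξ η : E} (h : ξ ≠ η) :
    ‖η‖ ^ (p - 2) * ⟪η, ξ⟫ < 1 / p * ‖ξ‖ ^ p + (p - 1) / p * ‖η‖ ^ p := by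
  by_cases hn : ‖ξ‖ = ‖η‖
  · have hη : 0 < ‖η‖ := by
      rw [norm_pos_iff]
      rintro rfl
      exact h (norm_eq_zero.1 (by simpa using hn))
    have h1 : ⟪η, ξ⟫ < ⟪η, η⟫ := by
      have h2 := norm_sub_sq_real ξ η
      have h3 : 0 < ‖ξ - η‖ := norm_pos_iff.2 (sub_ne_zero.2 h)
      rw [real_inner_self_eq_norm_sq, real_inner_comm]
      rw [hn] at h2
      nlinarith [pow_pos h3 2]
    have h4 := mul_lt_mul_of_pos_left h1 (Real.rpow_pos_of_pos hη (p - 2))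
    rw [norm_rpow_sub_two_mul_inner_self hp] at h4
    refine h4.trans_eq ?_
    rw [hn]
    field_simp
    ring
  · exact (norm_rpow_mul_inner_le hp ξ η).trans_lt
      (rpow_sub_one_mul_lt hp (norm_nonneg _) (norm_nonneg _) hn)

theorem norm_rpow_mul_inner_le_young (hp : 1 < p) (ξ η : E) :
    ‖η‖ ^ (p - 2) * ⟪η, ξ⟫ ≤ 1 / p * ‖ξ‖ ^ p + (p - 1) / p * ‖η‖ ^ p := by
  by_cases h : ξ = η
  · subst h
    rw [norm_rpow_sub_two_mul_inner_self hp]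
    refine le_of_eq ?_
    field_simp
    ring
  · exact (norm_rpow_mul_inner_lt hp h).le

/-- The pointwise inequality of Picone type behind the comparison principle: with
`μ = a (p - 1) / p`, the integrand obtained by testing with `A - B`, where `∇A = a A ξ` and
`∇B = a B η`, is a combination with positive coefficients of two Young deficits. -/
theorem picone_identity (hp : 1 < p) (a A B : ℝ) (ξ η : E) :
    ‖ξ‖ ^ (p - 2) * ⟪ξ, (a * A) • ξ - (a * B) • η⟫ - ‖η‖ ^ (p - 2) * ⟪η, (a * A) • ξ - (a * B) • η⟫
        - a * (p - 1) / p * (‖ξ‖ ^ p - ‖η‖ ^ p) * (A - B)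
      = a * A * (1 / p * ‖ξ‖ ^ p + (p - 1) / p * ‖η‖ ^ p - ‖η‖ ^ (p - 2) * ⟪η, ξ⟫)
        + a * B * (1 / p * ‖η‖ ^ p + (p - 1) / p * ‖ξ‖ ^ p - ‖ξ‖ ^ (p - 2) * ⟪ξ, η⟫) := by
  have h1 := norm_rpow_sub_two_mul_inner_self hp ξ
  have h2 := norm_rpow_sub_two_mul_inner_self hp η
  simp only [inner_sub_right, real_inner_smul_right]
  have e1 : ‖ξ‖ ^ (p - 2) * (a * A * ⟪ξ, ξ⟫ - a * B * ⟪ξ, η⟫)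
      = a * A * ‖ξ‖ ^ p - a * B * (‖ξ‖ ^ (p - 2) * ⟪ξ, η⟫) := by
    rw [← h1]
    ring
  have e2 : ‖η‖ ^ (p - 2) * (a * A * ⟪η, ξ⟫ - a * B * ⟪η, η⟫)
      = a * A * (‖η‖ ^ (p - 2) * ⟪η, ξ⟫) - a * B * ‖η‖ ^ p := by
    rw [← h2]
    ring
  rw [e1, e2]
  field_simp
  ring

end Young

/-! ### Integrability of the terms of the weak formulation -/

section Integrability

variable {N : ℕ} {Ω : Set (RN N)} {p : ℝ}

theorem MemLpOn.integrable_norm_rpow {F : Type*} [NormedAddCommGroup F] (hp : 1 < p) {G : RN N → F}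
    (hG : MemLpOn Ω p G) : Integrable (fun x => ‖G x‖ ^ p) (volume.restrict Ω) := by
  have h := MemLp.integrable_norm_rpow hG (by simpa using by linarith) ENNReal.ofReal_ne_top
  rwa [ENNReal.toReal_ofReal (by linarith)] at h

theorem MemLpOn.integrable_norm_rpow_mul_inner (hp : 1 < p) {G H : RN N → RN N}
    (hG : MemLpOn Ω p G) (hH : MemLpOn Ω p H) :
    Integrable (fun x => ‖G x‖ ^ (p - 2) * ⟪G x, H x⟫) (volume.restrict Ω) := by
  refine ((hG.integrable_norm_rpow hp).add (hH.integrable_norm_rpow hp)).mono'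
    ((hG.1.norm.aemeasurable.pow_const _).aestronglyMeasurable.mul (hG.1.inner hH.1))
    (Eventually.of_forall fun x => ?_)
  have h1 := norm_rpow_mul_inner_le_young hp (H x) (G x)
  have h2 := norm_rpow_mul_inner_le_young hp (-H x) (G x)
  rw [norm_neg, inner_neg_right] at h2
  have h3 : 0 ≤ ‖G x‖ ^ p := by positivity
  have h4 : 0 ≤ ‖H x‖ ^ p := by positivity
  have h5 : 1 / p ≤ 1 := (div_le_one (by linarith)).2 hp.le
  have h6 : (p - 1) / p ≤ 1 := (div_le_one (by linarith)).2 (by linarith)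
  have h7 := mul_le_mul_of_nonneg_right h5 h4
  have h8 := mul_le_mul_of_nonneg_right h6 h3
  simp only [Pi.add_apply, Real.norm_eq_abs]
  rw [abs_le]
  constructor <;> linarith

/-- The superposition of a Carathéodory function with a measurable function is measurable. -/
theorem IsL1Caratheodory.aemeasurable_comp {f : RN N → ℝ → ℝ} (hf : IsL1Caratheodory Ω f)
    {u : RN N → ℝ} (hu : AEMeasurable u (volume.restrict Ω)) :
    AEMeasurable (fun x => f x (u x)) (volume.restrict Ω) := by
  obtain ⟨v, hv, huv⟩ := hu
  have hsimple : ∀ s : SimpleFunc (RN N) ℝ,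
      AEMeasurable (fun x => f x (s x)) (volume.restrict Ω) := by
    intro s
    have e : (fun x => f x (s x))
        = fun x => ∑ c ∈ s.range, (s ⁻¹' {c}).indicator (fun x => f x c) x := by
      ext1 x
      rw [Finset.sum_eq_single (s x)]
      · simp
      · intro c _ hc
        exact Set.indicator_of_notMem (fun h => hc (by simpa using h.symm)) _
      · intro h
        exact absurd (s.mem_range_self x) h
    rw [e]
    exact Finset.aemeasurable_fun_sum _ fun c _ => (hf.1 c).indicator (s.measurableSet_preimage _)
  have hv' : AEMeasurable (fun x => f x (v x)) (volume.restrict Ω) := by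
    refine aemeasurable_of_tendsto_metrizable_ae atTop
      (fun n => hsimple (hv.stronglyMeasurable.approx n)) ?_
    filter_upwards [hf.2.1] with x hx
    exact (hx.tendsto _).comp (hv.stronglyMeasurable.tendsto_approx x)
  exact hv'.congr (huv.symm.mono fun x hx => by simp only [hx])

theorem IsL1Caratheodory.integrable_comp (hΩ : MeasurableSet Ω) {f : RN N → ℝ → ℝ}
    (hf : IsL1Caratheodory Ω f) {u : RN N → ℝ} (hu : AEMeasurable u (volume.restrict Ω)) {M : ℝ}
    (hM : ∀ x ∈ Ω, |u x| ≤ M) : Integrable (fun x => f x (u x)) (volume.restrict Ω) := by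
  obtain ⟨h, hh, hfh⟩ := hf.2.2 M
  refine Integrable.mono' hh (hf.aemeasurable_comp hu).aestronglyMeasurable ?_
  filter_upwards [hfh, ae_restrict_mem hΩ] with x hx hxΩ
  exact hx _ (hM x hxΩ)

end Integrability

/-! ### Comparison -/

section Comparison

variable {N : ℕ} {Ω : Set (RN N)}

theorem exp_sub_exp_le {a M s t : ℝ} (ha : 0 < a) (hs : |s| ≤ M) :
    max (Real.exp (a * s) - Real.exp (a * t)) 0 ≤ a * Real.exp (a * M) * max (s - t) 0 := by
  have hC : 0 < a * Real.exp (a * M) := by positivity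
  refine max_le ?_ (mul_nonneg hC.le (le_max_right _ _))
  rcases le_total s t with h | h
  · have h1 : Real.exp (a * s) ≤ Real.exp (a * t) :=
      Real.exp_le_exp.2 (mul_le_mul_of_nonneg_left h ha.le)
    exact (sub_nonpos.2 h1).trans (mul_nonneg hC.le (le_max_right _ _))
  · rw [max_eq_left (sub_nonneg.2 h)]
    have h1 : Real.exp (a * t) = Real.exp (a * s) * Real.exp (a * t - a * s) := by
      rw [← Real.exp_add]
      congr 1
      ring
    have h2 := Real.add_one_le_exp (a * t - a * s)
    have h3 : Real.exp (a * s) - Real.exp (a * t) ≤ Real.exp (a * s) * (a * (s - t)) := by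
      rw [h1]
      nlinarith [Real.exp_pos (a * s)]
    have h4 : Real.exp (a * s) ≤ Real.exp (a * M) :=
      Real.exp_le_exp.2 (mul_le_mul_of_nonneg_left ((le_abs_self s).trans hs) ha.le)
    have h5 := mul_le_mul_of_nonneg_right h4 (mul_nonneg ha.le (sub_nonneg.2 h))
    linarith

theorem le_on_closure_of_ae_le (hΩ : IsOpen Ω) {u v : RN N → ℝ} (hu : ContinuousOn u (closure Ω))
    (hv : ContinuousOn v (closure Ω)) (h : ∀ᵐ x ∂(volume.restrict Ω), u x ≤ v x) :
    ∀ x ∈ closure Ω, u x ≤ v x := by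
  have hO : IsOpen (Ω ∩ (fun x => u x - v x) ⁻¹' Set.Ioi 0) :=
    ((hu.sub hv).mono subset_closure).isOpen_inter_preimage hΩ isOpen_Ioi
  have h0 : volume (Ω ∩ (fun x => u x - v x) ⁻¹' Set.Ioi 0) = 0 := by
    rw [ae_restrict_iff' hΩ.measurableSet] at h
    refine measure_mono_null ?_ h
    rintro x ⟨hx, hx'⟩ hle
    have : 0 < u x - v x := hx'
    linarith [hle hx]
  have hΩle : ∀ x ∈ Ω, u x ≤ v x := by
    intro x hx
    by_contra hlt
    have hmem : x ∈ Ω ∩ (fun x => u x - v x) ⁻¹' Set.Ioi 0 := ⟨hx, by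
      change 0 < u x - v x
      linarith [not_le.1 hlt]⟩
    rw [(hO.measure_eq_zero_iff volume).1 h0] at hmem
    exact hmem
  intro x hx
  exact ContinuousWithinAt.closure_le hx ((hu x hx).mono subset_closure)
    ((hv x hx).mono subset_closure) hΩle

end Comparison

theorem theorem3p1 (N : ℕ) (hN : 2 ≤ N) (p : ℝ) (hp : 1 < p)
    (Ω : Set (RN N)) (hΩ_open : IsOpen Ω) (hΩ_conn : IsConnected Ω)
    (hΩ_bdd : Bornology.IsBounded Ω) (hΩ_lip : HasLipschitzBoundary Ω)
    (f : RN N → ℝ → ℝ) (hf : IsL1Caratheodory Ω f)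
    (hf_mono : ∀ᵐ x ∂(volume.restrict Ω), ∀ s t : ℝ, t ≤ s → f x s ≤ f x t)
    (μ : ℝ) (hμ : 0 < μ)
    (u₁ u₂ : RN N → ℝ)
    (hu₁_cont : ContinuousOn u₁ (closure Ω)) (hu₂_cont : ContinuousOn u₂ (closure Ω))
    (hu₁ : IsLowerSolution Ω p (fun x s ξ => μ * ‖ξ‖ ^ p + f x s) u₁)
    (hu₂ : IsUpperSolution Ω p (fun x s ξ => μ * ‖ξ‖ ^ p + f x s) u₂) :
    ∀ x ∈ closure Ω, u₁ x ≤ u₂ x := by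
  have hΩm := hΩ_open.measurableSet
  have : IsFiniteMeasure (volume.restrict Ω) := ⟨by simpa using hΩ_bdd.measure_lt_top⟩
  obtain ⟨M₁, hM₁⟩ := hΩ_bdd.isCompact_closure.exists_bound_of_continuousOn hu₁_cont
  obtain ⟨M₂, hM₂⟩ := hΩ_bdd.isCompact_closure.exists_bound_of_continuousOn hu₂_cont
  have hb₁ : ∀ x ∈ Ω, |u₁ x| ≤ max M₁ M₂ := fun x hx =>
    (hM₁ x (subset_closure hx)).trans (le_max_left _ _)
  have hb₂ : ∀ x ∈ Ω, |u₂ x| ≤ max M₁ M₂ := fun x hx =>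
    (hM₂ x (subset_closure hx)).trans (le_max_right _ _)
  set M := max M₁ M₂
  -- The exponent for which `μ = a (p - 1) / p`.
  obtain ⟨a, ha, hμa⟩ : ∃ a : ℝ, 0 < a ∧ μ = a * (p - 1) / p := by
    have hp1 : 0 < p - 1 := by linarith
    refine ⟨μ * p / (p - 1), by positivity, ?_⟩
    field_simp
  obtain ⟨hW₁, -, hpos₁, hlower⟩ := hu₁
  obtain ⟨hW₂, -, hpos₂, hupper⟩ := hu₂
  have hG₁ := hW₁.isWeakGradient
  have hG₂ := hW₂.isWeakGradient
  have hG₁p : MemLpOn Ω p (weakGradient Ω u₁) := hW₁.2.2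
  have hG₂p : MemLpOn Ω p (weakGradient Ω u₂) := hW₂.2.2
  set G₁ := weakGradient Ω u₁
  set G₂ := weakGradient Ω u₂
  have hm₁ : AEStronglyMeasurable u₁ (volume.restrict Ω) := hW₁.1.1
  have hm₂ : AEStronglyMeasurable u₂ (volume.restrict Ω) := hW₂.1.1
  -- `(u₁ - u₂)⁺` is in `W₀^{1,p}` because it is at most `u₁⁺ + u₂⁻`.
  let ψ : RN N → ℝ := fun x => max (u₁ x - u₂ x) 0
  have hψG := (hG₁.sub hG₂).posPart hΩ_open
  have hSψ : NullMeasurableSet {x | 0 < u₁ x - u₂ x} (volume.restrict Ω) :=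
    nullMeasurableSet_lt aemeasurable_const (hm₁.sub hm₂).aemeasurable
  have hψ : MemSobolevZero Ω p ψ := by
    refine (hpos₁.add hΩ_open hp.le hpos₂).of_nonneg_of_le hΩ_open hp.le
      (hψG.memSobolev hΩ_open (hW₁.1.sub hW₂.1).pos_part
        ((hG₁p.sub hG₂p).mono ((hG₁p.1.sub hG₂p.1).indicator₀ hSψ)
          (Eventually.of_forall fun x => norm_indicator_le_norm_self _ _)))
      (fun x _ => le_max_right _ _) fun x _ => ?_
    refine max_le ?_ (add_nonneg (le_max_right _ _) (le_max_right _ _))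
    linarith [le_max_left (u₁ x) 0, le_max_left (-u₂ x) 0]
  -- The common test function is `(exp (a u₁) - exp (a u₂))⁺`.
  have hexp : ∀ s, HasDerivAt (fun s => Real.exp (a * s)) (a * Real.exp (a * s)) s := fun s => by
    simpa [mul_comm] using ((hasDerivAt_id s).const_mul a).exp
  have hexp' : Continuous fun s => a * Real.exp (a * s) := by fun_prop
  let φ : RN N → ℝ := fun x => max (Real.exp (a * u₁ x) - Real.exp (a * u₂ x)) 0
  have hEG := (hG₁.comp_of_bounded hΩ_open hb₁ hexp hexp').sub
    (hG₂.comp_of_bounded hΩ_open hb₂ hexp hexp')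
  have hφG := hEG.posPart hΩ_open
  have hφm : AEStronglyMeasurable φ (volume.restrict Ω) := hφG.1.aestronglyMeasurable
  have hC : 0 < a * Real.exp (a * M) := by positivity
  have hbE : ∀ s, |s| ≤ M → ‖a * Real.exp (a * s)‖ ≤ a * Real.exp (a * M) := fun s hs => by
    rw [Real.norm_of_nonneg (by positivity)]
    refine mul_le_mul_of_nonneg_left (Real.exp_le_exp.2 ?_) ha.le
    exact mul_le_mul_of_nonneg_left ((le_abs_self s).trans hs) ha.le
  have hφb : ∀ᵐ x ∂(volume.restrict Ω), ‖φ x‖ ≤ Real.exp (a * M) := by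
    filter_upwards [ae_restrict_mem hΩm] with x hx
    rw [Real.norm_of_nonneg (le_max_right _ _)]
    refine max_le ?_ (Real.exp_pos _).le
    have : Real.exp (a * u₁ x) ≤ Real.exp (a * M) :=
      Real.exp_le_exp.2 (mul_le_mul_of_nonneg_left ((le_abs_self _).trans (hb₁ x hx)) ha.le)
    linarith [Real.exp_pos (a * u₂ x)]
  have hφp : MemLpOn Ω p φ := MemLp.of_bound hφm _ hφb
  have hΦp : MemLpOn Ω p ({x | 0 < Real.exp (a * u₁ x) - Real.exp (a * u₂ x)}.indicator fun x =>
      (a * Real.exp (a * u₁ x)) • G₁ x - (a * Real.exp (a * u₂ x)) • G₂ x) := by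
    refine MemLp.mono ((hG₁p.norm.add hG₂p.norm).const_mul (a * Real.exp (a * M)))
      hφG.2.1.aestronglyMeasurable ?_
    filter_upwards [ae_restrict_mem hΩm] with x hx
    refine (norm_indicator_le_norm_self _ _).trans ((norm_sub_le _ _).trans ?_)
    rw [norm_smul, norm_smul]
    refine (add_le_add (mul_le_mul_of_nonneg_right (hbE _ (hb₁ x hx)) (norm_nonneg _))
      (mul_le_mul_of_nonneg_right (hbE _ (hb₂ x hx)) (norm_nonneg _))).trans ?_
    rw [← mul_add]
    exact le_abs_self _
  have hφW : MemSobolev Ω p φ := hφG.memSobolev hΩ_open hφp hΦp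
  have hφ : MemSobolevZero Ω p φ :=
    (hψ.const_mul hΩ_open (a * Real.exp (a * M))).of_nonneg_of_le hΩ_open hp.le hφW
      (fun x _ => le_max_right _ _) fun x hx => exp_sub_exp_le ha (hb₁ x hx)
  have hφtop : MemLinftyOn Ω φ := memLp_top_of_bound hφm _ hφb
  have hφ0 : ∀ᵐ x ∂(volume.restrict Ω), 0 ≤ φ x := Eventually.of_forall fun x => le_max_right _ _
  have h₁ := hlower φ hφ hφtop hφ0
  have h₂ := hupper φ hφ hφtop hφ0
  have hφae := hφG.weakGradient_ae_eq hΩ_open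
  have iA₁ := hG₁p.integrable_norm_rpow_mul_inner hp hφW.2.2
  have iA₂ := hG₂p.integrable_norm_rpow_mul_inner hp hφW.2.2
  have iB₁ := (((hG₁p.integrable_norm_rpow hp).const_mul μ).add
    (hf.integrable_comp hΩm hm₁.aemeasurable hb₁)).mul_bdd hφm hφb
  have iB₂ := (((hG₂p.integrable_norm_rpow hp).const_mul μ).add
    (hf.integrable_comp hΩm hm₂.aemeasurable hb₂)).mul_bdd hφm hφb
  simp only [Pi.add_apply] at iB₁ iB₂
  -- `D` is the integrand of the difference of the two weak formulations.
  let D : RN N → ℝ := fun x =>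
    (‖G₁ x‖ ^ (p - 2) * ⟪G₁ x, weakGradient Ω φ x⟫ - ‖G₂ x‖ ^ (p - 2) * ⟪G₂ x, weakGradient Ω φ x⟫)
      - ((μ * ‖G₁ x‖ ^ p + f x (u₁ x)) * φ x - (μ * ‖G₂ x‖ ^ p + f x (u₂ x)) * φ x)
  have hDi : Integrable D (volume.restrict Ω) := (iA₁.sub iA₂).sub (iB₁.sub iB₂)
  have hDle : ∫ x in Ω, D x ≤ 0 := by
    have e : ∫ x in Ω, D x = _ := integral_sub (iA₁.sub iA₂) (iB₁.sub iB₂)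
    rw [integral_sub iA₁ iA₂, integral_sub iB₁ iB₂] at e
    linarith
  have key : ∀ᵐ x ∂(volume.restrict Ω), 0 ≤ D x ∧ (D x = 0 → 0 < u₁ x - u₂ x → G₁ x = G₂ x) := by
    filter_upwards [hφae, hf_mono] with x hx hfx
    rcases le_or_gt (u₁ x) (u₂ x) with hle | hlt
    · have hE : Real.exp (a * u₁ x) - Real.exp (a * u₂ x) ≤ 0 :=
        sub_nonpos.2 (Real.exp_le_exp.2 (mul_le_mul_of_nonneg_left hle ha.le))
      have hφx : φ x = 0 := max_eq_right hE
      have hgx : weakGradient Ω φ x = 0 := by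
        rw [hx]
        exact Set.indicator_of_notMem
          (s := {x | 0 < Real.exp (a * u₁ x) - Real.exp (a * u₂ x)}) (not_lt.2 hE) _
      refine ⟨le_of_eq ?_, fun _ h => absurd h (by linarith)⟩
      simp [D, hφx, hgx]
    · have hE : 0 < Real.exp (a * u₁ x) - Real.exp (a * u₂ x) :=
        sub_pos.2 (Real.exp_lt_exp.2 (mul_lt_mul_of_pos_left hlt ha))
      have hφx : φ x = Real.exp (a * u₁ x) - Real.exp (a * u₂ x) := max_eq_left hE.le
      have hgx : weakGradient Ω φ x
          = (a * Real.exp (a * u₁ x)) • G₁ x - (a * Real.exp (a * u₂ x)) • G₂ x := by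
        rw [hx]
        exact Set.indicator_of_mem (s := {x | 0 < Real.exp (a * u₁ x) - Real.exp (a * u₂ x)}) hE _
      have hpic := picone_identity hp a (Real.exp (a * u₁ x)) (Real.exp (a * u₂ x)) (G₁ x) (G₂ x)
      have hcoef₁ : 0 < a * Real.exp (a * u₁ x) := by positivity
      have hcoef₂ : 0 < a * Real.exp (a * u₂ x) := by positivity
      have hfφ := mul_nonneg (sub_nonneg.2 (hfx _ _ hlt.le)) hE.le
      have hDx : D x = a * Real.exp (a * u₁ x) * (1 / p * ‖G₁ x‖ ^ p + (p - 1) / p * ‖G₂ x‖ ^ p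
            - ‖G₂ x‖ ^ (p - 2) * ⟪G₂ x, G₁ x⟫)
          + a * Real.exp (a * u₂ x) * (1 / p * ‖G₂ x‖ ^ p + (p - 1) / p * ‖G₁ x‖ ^ p
            - ‖G₁ x‖ ^ (p - 2) * ⟪G₁ x, G₂ x⟫)
          + (f x (u₂ x) - f x (u₁ x)) * (Real.exp (a * u₁ x) - Real.exp (a * u₂ x)) := by
        rw [← hpic, ← hμa]
        simp only [D, hφx, hgx]
        ring
      have hY₁ := mul_nonneg hcoef₁.le
        (sub_nonneg.2 (norm_rpow_mul_inner_le_young hp (G₁ x) (G₂ x)))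
      have hY₂ := mul_nonneg hcoef₂.le
        (sub_nonneg.2 (norm_rpow_mul_inner_le_young hp (G₂ x) (G₁ x)))
      refine ⟨by rw [hDx]; positivity, fun hD0 _ => ?_⟩
      by_contra hne
      have hY := mul_pos hcoef₁ (sub_pos.2 (norm_rpow_mul_inner_lt hp hne))
      linarith
  have hD0 : ∀ᵐ x ∂(volume.restrict Ω), D x = 0 := by
    have hnn : 0 ≤ᵐ[volume.restrict Ω] D := key.mono fun x hx => hx.1
    exact (integral_eq_zero_iff_of_nonneg_ae hnn hDi).1
      (le_antisymm hDle (integral_nonneg_of_ae hnn))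
  have hψ0 := hψ.ae_eq_zero_of_gradient_eq_zero hΩ_open hΩ_bdd hp.le ⟨0, by lia⟩
    (fun x _ => le_max_right _ _) (by
      filter_upwards [hψG.weakGradient_ae_eq hΩ_open, key, hD0] with x hx hkx hDx
      rw [hx]
      by_cases hpos : 0 < u₁ x - u₂ x
      · simp [hkx.2 hDx hpos]
      · exact Set.indicator_of_notMem (s := {x | 0 < u₁ x - u₂ x}) hpos _)
  refine le_on_closure_of_ae_le hΩ_open hu₁_cont hu₂_cont ?_
  filter_upwards [hψ0] with x hx
  have : u₁ x - u₂ x ≤ ψ x := le_max_left _ _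
  linarith
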